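/- Let $n\ge 1$, let $r_1,\dots,r_n>0$, and let $$N=S^1_{r_1}\times\dots\times S^1_{r_n}\subset\mathbb{R}^{2n}$$ be the flat torus, where $S^1_{r}\subset\mathbb{R}^2$ is the circle of radius $r$ centred at the origin. Let $S^4\subset\mathbb{R}^5$ be the unit sphere, $S^4_+=\{x\in S^4: x_5\ge 0\}$ the closed upper halfsphere, and $\Delta_S$ the Laplace--Beltrami operator of the round metric. For $M\in\{S^4,S^4_+\}$, a map $u\in C^4(M,N)$ (up to the boundary if $M=S^4_+$) is called Paneitz-biharmonic if $$\Delta_S^2u(x)-2\Delta_Su(x)\perp T_{u(x)}N\qquad\text{for every }x\in M .$$ Then: 1. $N$ does not carry any non-constant Paneitz-biharmonic $4$-sphere: every Paneitz-biharmonic map $u\in C^4(S^4,N)$ is constant. 2. $N$ does not carry any non-constant Paneitz-biharmonic $4$-halfsphere with constant boundary values: if $u\in C^4(S^4_+,N)$ is Paneitz-biharmonic and $(u,Du)=(c,0)$ on $\partial S^4_+=\{x\in S^4:x_5=0\}$ for some $c\in N$, then $u=c$ on $S^4_+$. -/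

import Mathlib

open Set Metric Module
open scoped Manifold ContDiff InnerProductSpace

noncomputable section

namespace Paneitz

/-- Euclidean space `ℝ⁵`. -/
abbrev E5 : Type := EuclideanSpace ℝ (Fin 5)

/-- The unit sphere `S⁴ ⊂ ℝ⁵`, with Mathlib's structure of a smooth manifold. -/
abbrev S4 : Type := sphere (0 : E5) 1

/-- The closed upper halfsphere `S⁴₊ = {x ∈ S⁴ : x₅ ≥ 0}` (coordinates are numbered from `0`). -/
def halfSphere : Set S4 := {x | 0 ≤ (x : E5) 4}

/-- The boundary `∂S⁴₊ = {x ∈ S⁴ : x₅ = 0}` of the upper halfsphere. -/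
def equator : Set S4 := {x | (x : E5) 4 = 0}

/-- The radial projection `x ↦ x / |x|` of `ℝ⁵ ∖ {0}` onto `S⁴` (with an arbitrary value at `0`). -/
def radialProj (x : E5) : S4 :=
  if h : x = 0 then ⟨EuclideanSpace.single 4 1, by simp⟩
  else ⟨‖x‖⁻¹ • x, by
    rw [mem_sphere_zero_iff_norm, norm_smul, norm_inv, norm_norm,
      inv_mul_cancel₀ (norm_ne_zero_iff.mpr h)]⟩

/-- The cone `{x ∈ ℝ⁵ ∖ {0} : x / |x| ∈ M}` over a subset `M` of `S⁴`. It is `ℝ⁵ ∖ {0}` for the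
sphere, and the closed upper halfspace without the origin for the upper halfsphere. -/
def cone (M : Set S4) : Set E5 := {x | x ≠ 0 ∧ radialProj x ∈ M}

variable {F : Type*} [NormedAddCommGroup F] [InnerProductSpace ℝ F]

/-- The Laplace–Beltrami operator `Δ_S` of the round metric, for a map on `M ⊆ S⁴`, where `M` is
the sphere or the closed halfsphere: the restriction to `M` of the Euclidean Laplacian of the
extension `x ↦ u (x / |x|)` of `u` to the cone over `M` that is homogeneous of degree zero. The
derivatives are taken within the cone, hence up to the boundary (and one-sided there) if `M` is the
closed halfsphere; only the values of `u` on `M` matter. -/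
def laplaceBeltrami (M : Set S4) (u : S4 → F) (x : S4) : F :=
  InnerProductSpace.laplacianWithin (fun y : E5 => u (radialProj y)) (cone M) (x : E5)

/-- The Paneitz operator `u ↦ Δ_S² u - 2 Δ_S u`. -/
def paneitzOp (M : Set S4) (u : S4 → F) (x : S4) : F :=
  laplaceBeltrami M (laplaceBeltrami M u) x - (2 : ℝ) • laplaceBeltrami M u x

/-- The tangent space `T_p N` of an embedded submanifold `N` of `F`, as the set of velocities at
`p` of smooth curves in `N` through `p`. -/
def tangentVectors (N : Set F) (p : F) : Set F :=
  {v | ∃ γ : ℝ → F, ContDiff ℝ ∞ γ ∧ (∀ t, γ t ∈ N) ∧ γ 0 = p ∧ HasDerivAt γ v 0}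

/-- `u ∈ C⁴(M, N)` is Paneitz-biharmonic, i.e. `Δ_S² u(x) - 2 Δ_S u(x) ⊥ T_{u(x)} N` for all
`x ∈ M`. Here `M` is the sphere or the closed halfsphere, and `C⁴` is meant up to the boundary. -/
structure IsPaneitzBiharmonicOn (M : Set S4) (N : Set F) (u : S4 → F) : Prop where
  contMDiffOn : ContMDiffOn (𝓡 4) 𝓘(ℝ, F) 4 u M
  mapsTo : MapsTo u M N
  orthogonal : ∀ x ∈ M, ∀ v ∈ tangentVectors N (u x), ⟪paneitzOp M u x, v⟫_ℝ = 0

/-- `N` does not carry any non-constant Paneitz-biharmonic `4`-sphere. -/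
def CarriesNoSphere (N : Set F) : Prop :=
  ∀ u : S4 → F, IsPaneitzBiharmonicOn univ N u → ∃ c ∈ N, ∀ x, u x = c

/-- `N` does not carry any non-constant Paneitz-biharmonic `4`-halfsphere with constant boundary
values `(u, Du) = (c, 0)` on `∂S⁴₊`. -/
def CarriesNoHalfSphere (N : Set F) : Prop :=
  ∀ u : S4 → F, IsPaneitzBiharmonicOn halfSphere N u →
    ∀ c ∈ N, (∀ x ∈ equator, u x = c) →
      (∀ x ∈ equator, mfderivWithin (𝓡 4) 𝓘(ℝ, F) u halfSphere x = 0) →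
        ∀ x ∈ halfSphere, u x = c

/-- The flat torus `S¹_{r₁} × … × S¹_{rₙ} ⊂ (ℝ²)ⁿ = ℝ²ⁿ`; the coordinates of the `i`-th factor
`ℝ²` are those with the indices `(i, 0)` and `(i, 1)`. -/
def flatTorus {n : ℕ} (r : Fin n → ℝ) : Set (EuclideanSpace ℝ (Fin n × Fin 2)) :=
  {y | ∀ i, y (i, 0) ^ 2 + y (i, 1) ^ 2 = r i ^ 2}

end Paneitz

end

namespace Paneitz

/-! ### Partial derivatives within a set -/

/-! Each factor of the torus is treated separately. The sphere and the closed halfsphere are simply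
connected, so the component of `u` in the `i`-th circle is `r (cos φ, sin φ)` for a global phase
`φ`, as regular as `u`. Pairing the Paneitz equation with the rotation field of that circle, which
is tangent to the torus, leaves a scalar equation on the sphere, `Δ²φ - 2 div(|∇φ|² ∇φ) - 2 Δφ = 0`.
It is in divergence form with favourable signs: tested with `φ - c` it gives `∫ (Δφ)² + 2 |∇φ|⁴ + 2
|∇φ|² = 0`, so `∇φ = 0`. On the sphere there is no boundary term. On the halfsphere the boundary
terms vanish because `φ = c` and the normal derivative of `φ` is zero on the equator; the constant
value then extends to the boundary by continuity.

All analysis takes place in `ℝ⁵`, on extensions that are homogeneous of degree zero. Spherical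
operators become Euclidean ones weighted by powers of `‖x‖` (`sphLap`, `gradSq`), and spherical
gradients become vector fields tangent to the spheres about the origin. Multiplying such a field by
a radial cut-off does not disturb its divergence, so integration by parts on the sphere reduces to
the divergence theorem on a box (`divergence_eq_zero`). The scalar equation comes from
`phaseEquation_of_paneitz`, the energy identity is in `pd_eq_zero_of_phaseEquation`, and the phase
is built in `exists_phase_upperHalf` and `exists_phase_compl_zero`. -/

/-- The `i`-th partial derivative of `f` within `K`. -/
noncomputable def pd (K : Set E5) (i : Fin 5) (f : E5 → ℝ) (x : E5) : ℝ :=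
  fderivWithin ℝ f K x (EuclideanSpace.single i 1)

/-- The Laplacian within `K`, as the sum of the pure second partial derivatives. -/
noncomputable def lap (K : Set E5) (f : E5 → ℝ) (x : E5) : ℝ := ∑ i, pd K i (pd K i f) x

section pd

variable {K : Set E5} {f g : E5 → ℝ} {x : E5}

theorem pd_congr (h : EqOn f g K) (hx : x ∈ K) (i : Fin 5) : pd K i f x = pd K i g x := by
  simp only [pd, fderivWithin_congr h (h hx)]

theorem lap_congr (h : EqOn f g K) (hx : x ∈ K) : lap K f x = lap K g x :=
  Finset.sum_congr rfl fun i _ => pd_congr (fun _ hy => pd_congr h hy i) hx i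

theorem contDiffOn_pd (hK : UniqueDiffOn ℝ K) {m n : ℕ∞ω} (hf : ContDiffOn ℝ n f K)
    (hmn : m + 1 ≤ n) (i : Fin 5) : ContDiffOn ℝ m (pd K i f) K :=
  (hf.fderivWithin hK hmn).clm_apply contDiffOn_const

theorem contDiffOn_lap (hK : UniqueDiffOn ℝ K) {m n : ℕ∞ω} (hf : ContDiffOn ℝ n f K)
    (hmn : m + 1 + 1 ≤ n) : ContDiffOn ℝ m (lap K f) K :=
  ContDiffOn.sum fun i _ => contDiffOn_pd hK (contDiffOn_pd hK hf hmn i) le_rfl i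

theorem pd_add (hK : UniqueDiffOn ℝ K) (hx : x ∈ K) (hf : DifferentiableOn ℝ f K)
    (hg : DifferentiableOn ℝ g K) (i : Fin 5) :
    pd K i (fun y => f y + g y) x = pd K i f x + pd K i g x := by
  simp only [pd]
  rw [fderivWithin_fun_add (hK x hx) (hf x hx) (hg x hx)]; rfl

theorem pd_sub (hK : UniqueDiffOn ℝ K) (hx : x ∈ K) (hf : DifferentiableOn ℝ f K)
    (hg : DifferentiableOn ℝ g K) (i : Fin 5) :
    pd K i (fun y => f y - g y) x = pd K i f x - pd K i g x := by
  simp only [pd]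
  rw [fderivWithin_fun_sub (hK x hx) (hf x hx) (hg x hx)]; rfl

theorem pd_neg (hK : UniqueDiffOn ℝ K) (hx : x ∈ K) (i : Fin 5) :
    pd K i (fun y => -f y) x = -pd K i f x := by
  simp only [pd]
  rw [fderivWithin_fun_neg (hK x hx)]; rfl

theorem pd_mul (hK : UniqueDiffOn ℝ K) (hx : x ∈ K) (hf : DifferentiableOn ℝ f K)
    (hg : DifferentiableOn ℝ g K) (i : Fin 5) :
    pd K i (fun y => f y * g y) x = pd K i f x * g x + f x * pd K i g x := by
  simp only [pd]
  rw [fderivWithin_fun_mul (hK x hx) (hf x hx) (hg x hx)]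
  simp; ring

theorem pd_const_mul (hK : UniqueDiffOn ℝ K) (hx : x ∈ K) (hf : DifferentiableOn ℝ f K) (c : ℝ)
    (i : Fin 5) : pd K i (fun y => c * f y) x = c * pd K i f x := by
  simp only [pd]
  rw [((hf x hx).hasFDerivWithinAt.const_mul c).fderivWithin (hK x hx)]; rfl

theorem pd_sub_const (c : ℝ) (i : Fin 5) : pd K i (fun y => f y - c) x = pd K i f x := by
  simp only [pd]
  rw [fderivWithin_sub_const]

theorem lap_add (hK : UniqueDiffOn ℝ K) (hx : x ∈ K) (hf : ContDiffOn ℝ 2 f K)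
    (hg : ContDiffOn ℝ 2 g K) : lap K (fun y => f y + g y) x = lap K f x + lap K g x := by
  simp only [lap, ← Finset.sum_add_distrib]
  refine Finset.sum_congr rfl fun i _ => ?_
  have h1 {f : E5 → ℝ} (hf : ContDiffOn ℝ 2 f K) : DifferentiableOn ℝ f K :=
    hf.differentiableOn (by simp)
  have h2 {f : E5 → ℝ} (hf : ContDiffOn ℝ 2 f K) : DifferentiableOn ℝ (pd K i f) K :=
    (contDiffOn_pd hK (m := 1) hf (by norm_num) i).differentiableOn (by simp)
  rw [pd_congr (fun y hy => pd_add hK hy (h1 hf) (h1 hg) i) hx i,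
    pd_add hK hx (h2 hf) (h2 hg)]

theorem lap_neg (hK : UniqueDiffOn ℝ K) (hx : x ∈ K) :
    lap K (fun y => -f y) x = -lap K f x := by
  simp only [lap, ← Finset.sum_neg_distrib]
  refine Finset.sum_congr rfl fun i _ => ?_
  rw [pd_congr (fun y hy => pd_neg hK hy i) hx i, pd_neg hK hx]

theorem lap_mul (hK : UniqueDiffOn ℝ K) (hx : x ∈ K) (hf : ContDiffOn ℝ 2 f K)
    (hg : ContDiffOn ℝ 2 g K) : lap K (fun y => f y * g y) x =
      lap K f x * g x + 2 * ∑ i, pd K i f x * pd K i g x + f x * lap K g x := by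
  simp only [lap, Finset.mul_sum, Finset.sum_mul, ← Finset.sum_add_distrib]
  refine Finset.sum_congr rfl fun i _ => ?_
  have h1 {f : E5 → ℝ} (hf : ContDiffOn ℝ 2 f K) : DifferentiableOn ℝ f K :=
    hf.differentiableOn (by simp)
  have h2 {f : E5 → ℝ} (hf : ContDiffOn ℝ 2 f K) : DifferentiableOn ℝ (pd K i f) K :=
    (contDiffOn_pd hK (m := 1) hf (by norm_num) i).differentiableOn (by simp)
  rw [pd_congr (fun y hy => pd_mul hK hy (h1 hf) (h1 hg) i) hx i,
    pd_add hK hx ((h2 hf).fun_mul (h1 hg)) ((h1 hf).fun_mul (h2 hg)), pd_mul hK hx (h2 hf) (h1 hg),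
    pd_mul hK hx (h1 hf) (h2 hg)]
  ring

theorem laplacianWithin_eq_lap (hK : UniqueDiffOn ℝ K) (hx : x ∈ K) (hf : ContDiffOn ℝ 2 f K) :
    InnerProductSpace.laplacianWithin f K x = lap K f x := by
  rw [InnerProductSpace.laplacianWithin_eq_iteratedFDerivWithin_orthonormalBasis f hK hx
    (EuclideanSpace.basisFun (Fin 5) ℝ)]
  refine Finset.sum_congr rfl fun i _ => ?_
  have h : DifferentiableWithinAt ℝ (fderivWithin ℝ f K) K x :=
    (hf.fderivWithin hK (m := 1) (by norm_num)).differentiableOn (by simp) x hx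
  rw [iteratedFDerivWithin_two_apply f hK hx]
  have h1 := fderivWithin_clm_apply (hK x hx) h
    (differentiableWithinAt_const (EuclideanSpace.single i (1 : ℝ) : E5))
  change _ = fderivWithin ℝ (fun y => fderivWithin ℝ f K y (EuclideanSpace.single i 1)) K x _
  rw [h1]
  simp

/-- Partial derivatives lower the degree of homogeneity by one. -/
theorem pd_smul (hK : UniqueDiffOn ℝ K) (hcone : ∀ y ∈ K, ∀ t : ℝ, 0 < t → t • y ∈ K)
    (hf : DifferentiableOn ℝ f K) {k : ℕ}
    (hhom : ∀ y ∈ K, ∀ t : ℝ, 0 < t → t ^ k * f (t • y) = f y) (i : Fin 5) :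
    ∀ y ∈ K, ∀ t : ℝ, 0 < t → t ^ (k + 1) * pd K i f (t • y) = pd K i f y := by
  intro y hy t ht
  have h1 : HasFDerivWithinAt (fun z : E5 => t • z) (t • ContinuousLinearMap.id ℝ E5) K y :=
    ((hasFDerivAt_id y).const_smul t).hasFDerivWithinAt
  have h2 := ((hf (t • y) (hcone y hy t ht)).hasFDerivWithinAt.comp y h1
    (fun z hz => hcone z hz t ht)).const_mul (t ^ k)
  have h3 := (h2.congr (fun z hz => (hhom z hz t ht).symm) (hhom y hy t ht).symm).fderivWithin
    (hK y hy)
  simp only [pd, h3]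
  simp
  ring

/-- Two derivatives lower the degree from zero to `-2`. Hence `‖x‖²` times the Laplacian has degree
zero again and is the extension of the Laplace–Beltrami operator, ready to be iterated. -/
theorem lap_smul (hK : UniqueDiffOn ℝ K) (hcone : ∀ y ∈ K, ∀ t : ℝ, 0 < t → t • y ∈ K)
    (hf : ContDiffOn ℝ 2 f K)
    (hhom : ∀ y ∈ K, ∀ t : ℝ, 0 < t → f (t • y) = f y) :
    ∀ y ∈ K, ∀ t : ℝ, 0 < t → t ^ 2 * lap K f (t • y) = lap K f y := by
  intro y hy t ht
  simp only [lap, Finset.mul_sum]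
  refine Finset.sum_congr rfl fun i _ => ?_
  exact pd_smul hK hcone ((contDiffOn_pd hK (m := 1) hf (by norm_num) i).differentiableOn
    (by simp)) (k := 1) (pd_smul hK hcone (hf.differentiableOn (by simp)) (k := 0)
      (by simpa using hhom) i) i y hy t ht

/-- Euler's relation in degree zero. -/
theorem sum_mul_pd_eq_zero (hcone : ∀ y ∈ K, ∀ t : ℝ, 0 < t → t • y ∈ K)
    (hf : DifferentiableOn ℝ f K)
    (hhom : ∀ y ∈ K, ∀ t : ℝ, 0 < t → f (t • y) = f y) (hx : x ∈ K) :
    ∑ i, x i * pd K i f x = 0 := by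
  have h1 : HasDerivWithinAt (fun t : ℝ => t • x) x (Ioi 0) 1 := by
    simpa using ((hasDerivAt_id (1 : ℝ)).smul_const x).hasDerivWithinAt
  have hf1 : HasFDerivWithinAt f (fderivWithin ℝ f K x) K ((fun t : ℝ => t • x) 1) := by
    simpa using (hf x hx).hasFDerivWithinAt
  have h2 : HasDerivWithinAt (f ∘ fun t : ℝ => t • x) (fderivWithin ℝ f K x x) (Ioi 0) 1 :=
    hf1.comp_hasDerivWithinAt 1 h1 (fun t ht => hcone x hx t ht)
  have h3 : HasDerivWithinAt (fun _ : ℝ => f x) (fderivWithin ℝ f K x x) (Ioi 0) 1 :=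
    h2.congr (fun t ht => (hhom x hx t ht).symm) (by simp)
  have h4 : fderivWithin ℝ f K x x = 0 :=
    (isOpen_Ioi.uniqueDiffWithinAt (by simp : (1 : ℝ) ∈ Ioi 0)).eq_deriv _ h3
      (hasDerivWithinAt_const _ _ _)
  have h5 : ∑ i, x i • (EuclideanSpace.single i (1 : ℝ) : E5) = x := by
    simpa using (EuclideanSpace.basisFun (Fin 5) ℝ).sum_repr x
  calc ∑ i, x i * pd K i f x
      = fderivWithin ℝ f K x (∑ i, x i • (EuclideanSpace.single i (1 : ℝ) : E5)) := by
        simp only [map_sum, map_smul, smul_eq_mul, pd]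
    _ = 0 := by rw [h5, h4]

end pd


/-! ### The divergence theorem with a radial cut-off -/

/-- A smooth radial cut-off function, supported in `1 ≤ |x|² ≤ 3`. -/
noncomputable def cutoff (x : E5) : ℝ :=
  (⟨1 / 2, 1, by norm_num, by norm_num⟩ : ContDiffBump (2 : ℝ)) (‖x‖ ^ 2)

theorem cutoff_nonneg (x : E5) : 0 ≤ cutoff x := ContDiffBump.nonneg _

theorem cutoff_of_le_one {x : E5} (h : ‖x‖ ^ 2 ≤ 1) : cutoff x = 0 := by
  refine ContDiffBump.zero_of_le_dist _ ?_
  rw [Real.dist_eq, abs_of_nonpos (by linarith)]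
  change (1 : ℝ) ≤ _
  linarith

theorem cutoff_of_three_le {x : E5} (h : 3 ≤ ‖x‖ ^ 2) : cutoff x = 0 := by
  refine ContDiffBump.zero_of_le_dist _ ?_
  rw [Real.dist_eq, abs_of_nonneg (by linarith)]
  change (1 : ℝ) ≤ _
  linarith

theorem cutoff_of_eq_two {x : E5} (h : ‖x‖ ^ 2 = 2) : cutoff x = 1 := by
  refine ContDiffBump.one_of_mem_closedBall _ ?_
  rw [h]
  exact mem_closedBall_self (by norm_num)

theorem contDiff_cutoff : ContDiff ℝ 1 cutoff :=
  (ContDiffBump.contDiff _).comp (contDiff_norm_sq ℝ)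

/-- The gradient of a radial function is radial, hence orthogonal to every tangential field; this is
why the cut-off leaves no error term in the divergence theorem. -/
theorem fderiv_cutoff (x : E5) :
    ∃ c : ℝ, ∀ i, fderiv ℝ cutoff x (EuclideanSpace.single i 1) = c * x i := by
  let g : ContDiffBump (2 : ℝ) := ⟨1 / 2, 1, by norm_num, by norm_num⟩
  refine ⟨deriv g (‖x‖ ^ 2) * 2, fun i => ?_⟩
  have h1 : HasDerivAt g (deriv g (‖x‖ ^ 2)) (‖x‖ ^ 2) :=
    (g.contDiff.differentiable (n := 1) (by simp) _).hasDerivAt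
  have h2 := h1.comp_hasFDerivAt x (HasStrictFDerivAt.hasFDerivAt (hasStrictFDerivAt_norm_sq x))
  have h3 : fderiv ℝ cutoff x = _ := h2.fderiv
  rw [h3]
  simp [EuclideanSpace.inner_single_right]
  ring

/-- The cut-off removes the singularity that homogeneous functions have at the origin. -/
theorem cutoff_mul_eventuallyEq (f : E5 → ℝ) :
    (fun y => cutoff y * f y) =ᶠ[nhds 0] fun _ => 0 := by
  filter_upwards [ball_mem_nhds (0 : E5) one_pos] with y hy
  rw [mem_ball_zero_iff] at hy
  rw [cutoff_of_le_one (by nlinarith [norm_nonneg y]), zero_mul]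

theorem continuousOn_cutoff_mul {K S : Set E5} {f : E5 → ℝ} (hf : ContinuousOn f K)
    (hS : ∀ x ∈ S, x ≠ 0 → x ∈ K) : ContinuousOn (fun y => cutoff y * f y) S := by
  intro x hx
  by_cases h0 : x = 0
  · subst h0
    exact (continuousAt_const.congr (cutoff_mul_eventuallyEq f).symm).continuousWithinAt
  · have h1 : ContinuousWithinAt f (S \ {0}) x :=
      (hf x (hS x hx h0)).mono fun y hy => hS y hy.1 hy.2
    have h2 : ContinuousWithinAt f S x :=
      h1.mono_of_mem_nhdsWithin (Filter.inter_mem self_mem_nhdsWithin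
        (mem_nhdsWithin_of_mem_nhds (isOpen_ne.mem_nhds h0)))
    exact contDiff_cutoff.continuous.continuousWithinAt.mul h2

/-- Let `Z` be a tangential vector field on `K` with nonnegative divergence `F`. If the flux of `Z`
through the boundary vanishes, then `F` vanishes. Here `K` is a set that contains every
nonzero point of the halfspace `{x | b ≤ x₄}`. -/
theorem divergence_eq_zero {K : Set E5} {b : ℝ} (hb : b < 2)
    (hbox : ∀ x : E5, b ≤ x 4 → x ≠ 0 → x ∈ K)
    {Z : Fin 5 → E5 → ℝ} {F : E5 → ℝ} (hZ : ∀ i, ContDiffOn ℝ 1 (Z i) K)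
    (hrad : ∀ x ∈ K, ∑ i, x i * Z i x = 0) (hdiv : ∀ x ∈ K, ∑ i, pd K i (Z i) x = F x)
    (hF : ∀ x ∈ K, 0 ≤ F x) (hFc : ContinuousOn F K)
    (hbd : ∀ x ∈ K, x 4 = b → 3 ≤ ‖x‖ ^ 2 ∨ Z 4 x = 0)
    {x : E5} (hx : ‖x‖ ^ 2 = 2) (hxb : b < x 4) : F x = 0 := by
  -- The half-width `2` puts every face other than `x₄ = b` in `‖x‖² ≥ 4`, outside the support of
  -- the cut-off.
  let lo : Fin 5 → ℝ := fun i => if i = 4 then b else -2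
  let hi : Fin 5 → ℝ := fun _ => 2
  let e : (Fin 5 → ℝ) ≃L[ℝ] E5 := (EuclideanSpace.equiv (Fin 5) ℝ).symm
  have he : ∀ v i, e v i = v i := fun v i => rfl
  have hlo : ∀ i, lo i < 2 := by intro i; simp only [lo]; split_ifs <;> linarith
  have hlo4 : lo 4 = b := if_pos rfl
  have hmem : ∀ v ∈ Icc lo hi, e v ≠ 0 → e v ∈ K := fun v hv h0 =>
    hbox _ (hlo4.symm.le.trans (hv.1 4)) h0
  let f : Fin 5 → (Fin 5 → ℝ) → ℝ := fun i v => cutoff (e v) * Z i (e v)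
  let G : (Fin 5 → ℝ) → ℝ := fun v => cutoff (e v) * F (e v)
  have hcont : ∀ {h : E5 → ℝ}, ContinuousOn h K →
      ContinuousOn (fun v => cutoff (e v) * h (e v)) (Icc lo hi) := by
    intro h hh
    exact (continuousOn_cutoff_mul (S := e '' Icc lo hi) hh
      (by rintro _ ⟨v, hv, rfl⟩ h0; exact hmem v hv h0)).comp e.continuous.continuousOn
        (mapsTo_image _ _)
  have hGc : ContinuousOn G (Icc lo hi) := hcont hFc
  have hsq : ∀ (y : E5) (i : Fin 5), (y i) ^ 2 ≤ ‖y‖ ^ 2 := by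
    intro y i
    rw [EuclideanSpace.norm_sq_eq]
    have := Finset.single_le_sum (f := fun j => ‖y j‖ ^ 2) (fun j _ => by positivity)
      (Finset.mem_univ i)
    simp only [Real.norm_eq_abs, sq_abs] at this ⊢
    exact this
  have hU : IsOpen (Set.pi univ fun i => Ioo (lo i) (hi i)) :=
    isOpen_set_pi finite_univ fun i _ => isOpen_Ioo
  have hUsub : (Set.pi univ fun i => Ioo (lo i) (hi i)) ⊆ Icc lo hi := fun v hv =>
    ⟨fun i => (hv i trivial).1.le, fun i => (hv i trivial).2.le⟩
  -- the derivatives in the interior of the box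
  have hd : ∀ v ∈ (Set.pi univ fun i => Ioo (lo i) (hi i)) \ {0}, (∀ i, HasFDerivAt (f i)
      (fderiv ℝ (f i) v) v) ∧ ∑ i, fderiv ℝ (f i) v (Pi.single i 1) = G v := by
    rintro v ⟨hv, hv0⟩
    have hev : e v ≠ 0 := by simpa using hv0
    have hKn : K ∈ nhds (e v) := by
      have h1 : {y : E5 | b < y 4} ∈ nhds (e v) :=
        (isOpen_lt continuous_const (by fun_prop)).mem_nhds (hlo4.symm.trans_lt (hv 4 trivial).1)
      filter_upwards [h1, isOpen_ne.mem_nhds hev] with y hy hy0 using hbox y (le_of_lt hy) hy0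
    have hK : e v ∈ K := mem_of_mem_nhds hKn
    have h1 : ∀ i, HasFDerivAt (f i) ((cutoff (e v) • fderiv ℝ (Z i) (e v) +
        Z i (e v) • fderiv ℝ cutoff (e v)).comp (e : (Fin 5 → ℝ) →L[ℝ] E5)) v := by
      intro i
      have hZd := ((hZ i).differentiableOn (by simp) _ hK).differentiableAt hKn
      have hcd := contDiff_cutoff.differentiable (by simp) (e v)
      exact (hcd.hasFDerivAt.mul hZd.hasFDerivAt).comp v e.hasFDerivAt
    refine ⟨fun i => by rw [(h1 i).fderiv]; exact h1 i, ?_⟩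
    have hes : ∀ i, e (Pi.single i 1) = EuclideanSpace.single i 1 := fun i => rfl
    have h2 : ∀ i, fderiv ℝ (f i) v (Pi.single i 1) = cutoff (e v) * pd K i (Z i) (e v) +
        Z i (e v) * fderiv ℝ cutoff (e v) (EuclideanSpace.single i 1) := by
      intro i
      rw [(h1 i).fderiv, pd, fderivWithin_of_mem_nhds hKn, ← hes]
      simp
    obtain ⟨c, hc⟩ := fderiv_cutoff (e v)
    simp only [h2, hc, Finset.sum_add_distrib, ← Finset.mul_sum, hdiv _ hK]
    -- The derivative of the cut-off contributes a multiple of the radial component of `Z`, which is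
    -- zero.
    have h3 : ∑ i, Z i (e v) * (c * e v i) = c * ∑ i, e v i * Z i (e v) := by
      rw [Finset.mul_sum]; exact Finset.sum_congr rfl fun i _ => by ring
    rw [h3, hrad _ hK]
    simp [G]
  have hae : (fun v => ∑ i, fderiv ℝ (f i) v (Pi.single i 1)) =ᵐ[MeasureTheory.volume.restrict
      (Icc lo hi)] G := by
    have h1 : (Set.pi univ fun i => Ioo (lo i) (hi i)) =ᵐ[MeasureTheory.volume] Icc lo hi :=
      MeasureTheory.Measure.univ_pi_Ioo_ae_eq_Icc
    rw [← MeasureTheory.Measure.restrict_congr_set h1]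
    have h2 : ∀ᵐ v : Fin 5 → ℝ, v ≠ 0 := MeasureTheory.Measure.ae_ne _ _
    filter_upwards [MeasureTheory.ae_restrict_mem hU.measurableSet,
      MeasureTheory.ae_restrict_of_ae h2] with v hv hv0 using (hd v ⟨hv, hv0⟩).2
  have hGi : MeasureTheory.IntegrableOn G (Icc lo hi) := hGc.integrableOn_compact isCompact_Icc
  -- Only continuity is needed on the closed box, and differentiability inside it off `{0}`; so
  -- one-sided derivatives on the face `x₄ = b` and the missing origin do no harm.
  have hint := MeasureTheory.integral_divergence_of_hasFDerivAt_off_countable' lo hi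
    (fun i => (hlo i).le) f (fun i => fderiv ℝ (f i)) {0} (countable_singleton _)
    (fun i => hcont (hZ i).continuousOn) (fun v hv => (hd v hv).1) (hGi.congr hae.symm)
  have hzero : ∀ (i : Fin 5) (y : E5), (y i = lo i ∨ y i = 2) → (b ≤ y 4) →
      cutoff y * Z i y = 0 := by
    intro i y hy hyb
    by_cases hy0 : y = 0
    · rw [hy0, cutoff_of_le_one (by simp), zero_mul]
    by_cases h3 : 3 ≤ ‖y‖ ^ 2
    · rw [cutoff_of_three_le h3, zero_mul]
    have h4 := hsq y i
    rcases hy with hy | hy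
    · by_cases hi4 : i = 4
      · subst hi4
        rcases hbd y (hbox y hyb hy0) (by simpa [lo] using hy) with h | h
        · exact absurd h h3
        · rw [h, mul_zero]
      · simp only [lo, if_neg hi4] at hy
        rw [hy] at h4
        exact absurd (by linarith) h3
    · rw [hy] at h4
      exact absurd (by linarith) h3
  have hface : ∀ (i : Fin 5) (t : ℝ), (t = lo i ∨ t = 2) → ∀ w ∈ Icc (lo ∘ i.succAbove)
      (hi ∘ i.succAbove), f i (i.insertNth t w) = 0 := by
    intro i t ht w hw
    refine hzero i _ (by simpa [he] using ht) ?_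
    rw [he]
    by_cases hi4 : i = 4
    · subst hi4
      rw [Fin.insertNth_apply_same]
      rcases ht with rfl | rfl
      · exact hlo4.ge
      · exact hb.le
    · obtain ⟨j, hj⟩ := Fin.exists_succAbove_eq (Ne.symm hi4)
      rw [← hj, Fin.insertNth_apply_succAbove]
      have : lo (i.succAbove j) ≤ w j := hw.1 j
      rwa [hj, hlo4] at this
  have hint0 : ∫ v in Icc lo hi, G v = 0 := by
    rw [← MeasureTheory.integral_congr_ae hae, hint]
    refine Finset.sum_eq_zero fun i _ => ?_
    rw [MeasureTheory.setIntegral_congr_fun measurableSet_Icc (hface i _ (Or.inr rfl)),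
      MeasureTheory.setIntegral_congr_fun measurableSet_Icc (hface i _ (Or.inl rfl))]
    simp
  have hG0 : ∀ v ∈ Icc lo hi, 0 ≤ G v := by
    intro v hv
    by_cases h0 : e v = 0
    · simp only [G, h0, cutoff_of_le_one (x := 0) (by simp), zero_mul, le_refl]
    · exact mul_nonneg (cutoff_nonneg _) (hF _ (hmem v hv h0))
  have hGae := (MeasureTheory.setIntegral_eq_zero_iff_of_nonneg_ae
    (MeasureTheory.ae_restrict_of_forall_mem measurableSet_Icc hG0) hGi).1 hint0
  -- Vanishing almost everywhere becomes vanishing at every point of the open box, by continuity; at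
  -- `‖x‖² = 2` the cut-off is `1`.
  have hGU := MeasureTheory.Measure.eqOn_open_of_ae_eq
    (MeasureTheory.ae_restrict_of_ae_restrict_of_subset hUsub hGae) hU (hGc.mono hUsub)
    continuousOn_const
  have hxU : e.symm x ∈ Set.pi univ fun i => Ioo (lo i) (hi i) := by
    intro i _
    have hxi : e.symm x i = x i := rfl
    have := hsq x i
    rw [hx] at this
    rw [hxi]
    refine ⟨?_, by simp only [hi]; nlinarith⟩
    by_cases hi4 : i = 4
    · subst hi4; simpa [lo] using hxb
    · simp only [lo, if_neg hi4]; nlinarith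
  have := hGU hxU
  simpa [G, cutoff_of_eq_two hx] using this

/-! ### The equation for the phase -/

/-- The squared length of the gradient, made homogeneous of degree zero. -/
noncomputable def gradSq (K : Set E5) (φ : E5 → ℝ) (x : E5) : ℝ :=
  ‖x‖ ^ 2 * ∑ i, pd K i φ x * pd K i φ x

/-- The Laplacian, made homogeneous of degree zero. -/
noncomputable def sphLap (K : Set E5) (φ : E5 → ℝ) (x : E5) : ℝ := ‖x‖ ^ 2 * lap K φ x

section phase

variable {K : Set E5} {φ : E5 → ℝ}

theorem contDiffOn_gradSq (hK : UniqueDiffOn ℝ K) (hφ : ContDiffOn ℝ 4 φ K) :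
    ContDiffOn ℝ 2 (gradSq K φ) K := by
  have h (i : Fin 5) : ContDiffOn ℝ 2 (pd K i φ) K := contDiffOn_pd hK hφ (by norm_num) i
  exact (contDiff_norm_sq ℝ).contDiffOn.mul (ContDiffOn.sum fun i _ => (h i).mul (h i))

theorem contDiffOn_sphLap (hK : UniqueDiffOn ℝ K) (hφ : ContDiffOn ℝ 4 φ K) :
    ContDiffOn ℝ 2 (sphLap K φ) K :=
  (contDiff_norm_sq ℝ).contDiffOn.mul (contDiffOn_lap hK hφ (by norm_num))

theorem sphLap_smul (hK : UniqueDiffOn ℝ K) (hcone : ∀ y ∈ K, ∀ t : ℝ, 0 < t → t • y ∈ K)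
    (hφ : ContDiffOn ℝ 2 φ K) (hhom : ∀ y ∈ K, ∀ t : ℝ, 0 < t → φ (t • y) = φ y) :
    ∀ y ∈ K, ∀ t : ℝ, 0 < t → sphLap K φ (t • y) = sphLap K φ y := by
  intro y hy t ht
  simp only [sphLap]
  rw [← lap_smul hK hcone hφ hhom y hy t ht, norm_smul, Real.norm_of_nonneg ht.le]
  ring

theorem pd_smul_of_homogeneous (hK : UniqueDiffOn ℝ K)
    (hcone : ∀ y ∈ K, ∀ t : ℝ, 0 < t → t • y ∈ K)
    (hφ : DifferentiableOn ℝ φ K) (hhom : ∀ y ∈ K, ∀ t : ℝ, 0 < t → φ (t • y) = φ y) (i : Fin 5) :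
    ∀ y ∈ K, ∀ t : ℝ, 0 < t → t * pd K i φ (t • y) = pd K i φ y := by
  simpa using pd_smul hK hcone hφ (k := 0) (by simpa using hhom) i

theorem gradSq_smul (hK : UniqueDiffOn ℝ K) (hcone : ∀ y ∈ K, ∀ t : ℝ, 0 < t → t • y ∈ K)
    (hφ : DifferentiableOn ℝ φ K) (hhom : ∀ y ∈ K, ∀ t : ℝ, 0 < t → φ (t • y) = φ y) :
    ∀ y ∈ K, ∀ t : ℝ, 0 < t → gradSq K φ (t • y) = gradSq K φ y := by
  intro y hy t ht
  simp only [gradSq]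
  simp only [← pd_smul_of_homogeneous hK hcone hφ hhom _ y hy t ht, norm_smul,
    Real.norm_of_nonneg ht.le, Finset.mul_sum]
  exact Finset.sum_congr rfl fun i _ => by ring

/-- The Euler–Lagrange equation for the phase `φ`, at `x`. -/
def PhaseEquation (K : Set E5) (φ : E5 → ℝ) (x : E5) : Prop :=
  lap K (sphLap K φ) x - 2 * ∑ i, pd K i (gradSq K φ) x * pd K i φ x
    - 2 * (gradSq K φ x * lap K φ x) - 2 * lap K φ x = 0

/-- Every term has degree `-2`, so the equation propagates along rays and is only needed on the unit
sphere. -/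
theorem PhaseEquation.smul (hK : UniqueDiffOn ℝ K) (hcone : ∀ y ∈ K, ∀ t : ℝ, 0 < t → t • y ∈ K)
    (hφ : ContDiffOn ℝ 4 φ K) (hhom : ∀ y ∈ K, ∀ t : ℝ, 0 < t → φ (t • y) = φ y)
    {x : E5} (hx : x ∈ K) {t : ℝ} (ht : 0 < t) (h : PhaseEquation K φ (t • x)) :
    PhaseEquation K φ x := by
  have hφ2 : ContDiffOn ℝ 2 φ K := hφ.of_le (by norm_num)
  have hφ1 : DifferentiableOn ℝ φ K := hφ.differentiableOn (by norm_num)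
  have h1 := lap_smul hK hcone (contDiffOn_sphLap hK hφ) (sphLap_smul hK hcone hφ2 hhom) x hx t ht
  have h2 := fun i => pd_smul_of_homogeneous hK hcone
    ((contDiffOn_gradSq hK hφ).differentiableOn (by norm_num))
    (gradSq_smul hK hcone hφ1 hhom) i x hx t ht
  have h3 := fun i => pd_smul_of_homogeneous hK hcone hφ1 hhom i x hx t ht
  have h4 := lap_smul hK hcone hφ2 hhom x hx t ht
  have h5 := gradSq_smul hK hcone hφ1 hhom x hx t ht
  unfold PhaseEquation at h ⊢
  simp only [← h1, ← h2, ← h3, ← h4, ← h5]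
  have h6 : ∑ i, t * pd K i (gradSq K φ) (t • x) * (t * pd K i φ (t • x)) =
      t ^ 2 * ∑ i, pd K i (gradSq K φ) (t • x) * pd K i φ (t • x) := by
    rw [Finset.mul_sum]; exact Finset.sum_congr rfl fun i _ => by ring
  rw [h6]
  linear_combination t ^ 2 * h

/-- Testing the equation for the phase with the phase itself shows that its gradient vanishes. -/
theorem pd_eq_zero_of_phaseEquation (hK : UniqueDiffOn ℝ K)
    (hcone : ∀ y ∈ K, ∀ t : ℝ, 0 < t → t • y ∈ K) (hK0 : ∀ y ∈ K, y ≠ 0)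
    {b : ℝ} (hb : b < 2) (hbox : ∀ x : E5, b ≤ x 4 → x ≠ 0 → x ∈ K)
    (hφ : ContDiffOn ℝ 4 φ K) (hhom : ∀ y ∈ K, ∀ t : ℝ, 0 < t → φ (t • y) = φ y)
    (heq : ∀ x ∈ K, ‖x‖ = 1 → PhaseEquation K φ x) {c : ℝ}
    (hbd : ∀ x ∈ K, x 4 = b → 3 ≤ ‖x‖ ^ 2 ∨ (φ x = c ∧ pd K 4 φ x = 0))
    {x : E5} (hx : ‖x‖ ^ 2 = 2) (hxb : b < x 4) (i : Fin 5) : pd K i φ x = 0 := by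
  have hφ2 : ContDiffOn ℝ 2 φ K := hφ.of_le (by norm_num)
  have hφ1 : DifferentiableOn ℝ φ K := hφ.differentiableOn (by norm_num)
  have hp := contDiffOn_gradSq hK hφ
  have hq := contDiffOn_sphLap hK hφ
  have hp1 : ContDiffOn ℝ 1 (gradSq K φ) K := hp.of_le (by norm_num)
  have hq1 : ContDiffOn ℝ 1 (sphLap K φ) K := hq.of_le (by norm_num)
  have hdφ (i : Fin 5) : ContDiffOn ℝ 1 (pd K i φ) K := contDiffOn_pd hK hφ (by norm_num) i
  have hdq (i : Fin 5) : ContDiffOn ℝ 1 (pd K i (sphLap K φ)) K :=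
    contDiffOn_pd hK hq (by norm_num) i
  have hζ : ContDiffOn ℝ 1 (fun y => φ y - c) K := (hφ.of_le (by norm_num)).sub contDiffOn_const
  have hL : ContinuousOn (lap K φ) K :=
    (contDiffOn_lap hK hφ (m := 0) (by norm_num)).continuousOn
  -- With `ζ = φ - c`, `q = sphLap` and `p = gradSq`, this is `Z = q ∇φ - ζ ∇q + 2 ζ (p + 1) ∇φ`,
  -- the flux of the equation tested with `ζ`. Its divergence is the energy density `F` minus `ζ`
  -- times the equation; the terms `∇q · ∇φ` cancel.
  let Z : Fin 5 → E5 → ℝ := fun i y =>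
    (sphLap K φ y + 2 * ((φ y - c) * gradSq K φ y) + 2 * (φ y - c)) * pd K i φ y
      - (φ y - c) * pd K i (sphLap K φ) y
  let F : E5 → ℝ := fun y => sphLap K φ y * lap K φ y
    + 2 * ((gradSq K φ y + 1) * ∑ i, pd K i φ y * pd K i φ y)
  have hC : ContDiffOn ℝ 1 (fun y => sphLap K φ y + 2 * ((φ y - c) * gradSq K φ y)
      + 2 * (φ y - c)) K :=
    (hq1.add (contDiffOn_const.mul (hζ.mul hp1))).add (contDiffOn_const.mul hζ)
  have hd1 {f : E5 → ℝ} (hf : ContDiffOn ℝ 1 f K) : DifferentiableOn ℝ f K :=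
    hf.differentiableOn (by norm_num)
  have hpos : ∀ y, 0 ≤ ∑ i, pd K i φ y * pd K i φ y := fun y =>
    Finset.sum_nonneg fun i _ => mul_self_nonneg _
  have hp0 : ∀ y, 0 ≤ gradSq K φ y := fun y => mul_nonneg (by positivity) (hpos y)
  have hqL : ∀ y, 0 ≤ sphLap K φ y * lap K φ y := fun y => by
    have : sphLap K φ y * lap K φ y = ‖y‖ ^ 2 * (lap K φ y) ^ 2 := by simp only [sphLap]; ring
    rw [this]; positivity
  have hxK : x ∈ K := hbox x hxb.le (by rintro rfl; simp at hx)
  have key : F x = 0 := by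
    refine divergence_eq_zero (Z := Z) hb hbox ?_ ?_ ?_ ?_ ?_ ?_ hx hxb
    · exact fun i => (hC.mul (hdφ i)).sub (hζ.mul (hdq i))
    · intro y hy
      have h1 := sum_mul_pd_eq_zero hcone hφ1 hhom hy
      have h2 := sum_mul_pd_eq_zero hcone (hd1 hq1) (sphLap_smul hK hcone hφ2 hhom) hy
      have h3 : ∑ i, y i * Z i y =
          (sphLap K φ y + 2 * ((φ y - c) * gradSq K φ y) + 2 * (φ y - c)) *
            (∑ i, y i * pd K i φ y) - (φ y - c) * ∑ i, y i * pd K i (sphLap K φ) y := by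
        simp only [Z, Finset.mul_sum, ← Finset.sum_sub_distrib]
        exact Finset.sum_congr rfl fun i _ => by ring
      rw [h3, h1, h2]; ring
    · intro y hy
      have hE : PhaseEquation K φ y := by
        have hn : 0 < ‖y‖ := norm_pos_iff.2 (hK0 y hy)
        refine PhaseEquation.smul hK hcone hφ hhom hy (inv_pos.2 hn)
          (heq _ (hcone y hy _ (inv_pos.2 hn)) ?_)
        rw [norm_smul, norm_inv, norm_norm, inv_mul_cancel₀ hn.ne']
      have hCi : ∀ i, pd K i (fun y => sphLap K φ y + 2 * ((φ y - c) * gradSq K φ y)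
          + 2 * (φ y - c)) y = pd K i (sphLap K φ) y + 2 * (pd K i φ y * gradSq K φ y +
            (φ y - c) * pd K i (gradSq K φ) y) + 2 * pd K i φ y := by
        intro i
        have e1 : DifferentiableOn ℝ (fun y => 2 * ((φ y - c) * gradSq K φ y)) K :=
          hd1 (contDiffOn_const.mul (hζ.mul hp1))
        have e2 : DifferentiableOn ℝ (fun y => 2 * (φ y - c)) K :=
          hd1 (contDiffOn_const.mul hζ)
        have e3 : DifferentiableOn ℝ
            (fun y => sphLap K φ y + 2 * ((φ y - c) * gradSq K φ y)) K := (hd1 hq1).fun_add e1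
        rw [pd_add hK hy e3 e2, pd_add hK hy (hd1 hq1) e1, pd_const_mul hK hy (hd1 hζ),
          pd_const_mul hK hy ((hd1 hζ).fun_mul (hd1 hp1)), pd_mul hK hy (hd1 hζ) (hd1 hp1),
          pd_sub_const]
      have hZi : ∀ i, pd K i (Z i) y =
          (sphLap K φ y + 2 * ((φ y - c) * gradSq K φ y) + 2 * (φ y - c)) * pd K i (pd K i φ) y
          - (φ y - c) * pd K i (pd K i (sphLap K φ)) y
          + 2 * (φ y - c) * (pd K i (gradSq K φ) y * pd K i φ y)
          + 2 * (gradSq K φ y + 1) * (pd K i φ y * pd K i φ y) := by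
        intro i
        simp only [Z]
        rw [pd_sub hK hy ((hd1 hC).fun_mul (hd1 (hdφ i))) ((hd1 hζ).fun_mul (hd1 (hdq i))),
          pd_mul hK hy (hd1 hC) (hd1 (hdφ i)), pd_mul hK hy (hd1 hζ) (hd1 (hdq i)), hCi,
          pd_sub_const]
        ring
      simp only [hZi, Finset.sum_add_distrib, Finset.sum_sub_distrib, ← Finset.mul_sum]
      unfold PhaseEquation at hE
      simp only [F]
      change _ * lap K φ y - _ * lap K (sphLap K φ) y + _ + _ = _
      linear_combination -(φ y - c) * hE
    · exact fun y _ => add_nonneg (hqL y)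
        (mul_nonneg zero_le_two (mul_nonneg (by linarith [hp0 y]) (hpos y)))
    · exact (hq.continuousOn.mul hL).add (continuousOn_const.mul
        ((hp.continuousOn.add continuousOn_const).mul (continuousOn_finsetSum _ fun i _ =>
          (hdφ i).continuousOn.mul (hdφ i).continuousOn)))
    · intro y hy hyb
      refine (hbd y hy hyb).imp_right fun ⟨h1, h2⟩ => ?_
      simp only [Z, h1, h2]
      ring
  have h1 : ∑ i, pd K i φ x * pd K i φ x = 0 := by
    simp only [F] at key
    nlinarith [hqL x, mul_nonneg (hp0 x) (hpos x), hpos x]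
  have h2 := (Finset.sum_eq_zero_iff_of_nonneg (fun i _ => mul_self_nonneg _)).1 h1 i
    (Finset.mem_univ i)
  exact mul_self_eq_zero.1 h2

/-- The gradient of the map `(A, B) = (r cos φ, r sin φ)` in terms of the phase. -/
theorem pd_of_phase (hK : UniqueDiffOn ℝ K) (hφ : DifferentiableOn ℝ φ K) {r : ℝ} {A B : E5 → ℝ}
    (hA : ∀ y ∈ K, A y = r * Real.cos (φ y)) (hB : ∀ y ∈ K, B y = r * Real.sin (φ y))
    (i : Fin 5) {y : E5} (hy : y ∈ K) :
    pd K i A y = -(B y * pd K i φ y) ∧ pd K i B y = A y * pd K i φ y := by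
  constructor
  · rw [pd_congr hA hy, hB y hy, pd,
      ((hφ y hy).hasFDerivWithinAt.cos.const_mul r).fderivWithin (hK y hy)]
    simp [pd]; ring
  · rw [pd_congr hB hy, hA y hy, pd,
      ((hφ y hy).hasFDerivWithinAt.sin.const_mul r).fderivWithin (hK y hy)]
    simp [pd]; ring

/-- The Paneitz equation for `(A, B) = (r cos φ, r sin φ)` is the equation for the phase. -/
theorem phaseEquation_of_paneitz (hK : UniqueDiffOn ℝ K) (hφ : ContDiffOn ℝ 4 φ K)
    {r : ℝ} (hr : 0 < r) {A B WA WB : E5 → ℝ}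
    (hA : ∀ y ∈ K, A y = r * Real.cos (φ y)) (hB : ∀ y ∈ K, B y = r * Real.sin (φ y))
    (hWA : ∀ y ∈ K, WA y = ‖y‖ ^ 2 * lap K A y) (hWB : ∀ y ∈ K, WB y = ‖y‖ ^ 2 * lap K B y)
    {x : E5} (hx : x ∈ K) (hx1 : ‖x‖ = 1)
    (h : (lap K WB x - 2 * lap K B x) * A x - (lap K WA x - 2 * lap K A x) * B x = 0) :
    PhaseEquation K φ x := by
  have hφ2 : ContDiffOn ℝ 2 φ K := hφ.of_le (by norm_num)
  have hφ1 : DifferentiableOn ℝ φ K := hφ.differentiableOn (by norm_num)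
  have hp := contDiffOn_gradSq hK hφ
  have hq := contDiffOn_sphLap hK hφ
  have hA2 : ContDiffOn ℝ 2 A K :=
    (contDiffOn_const.mul (Real.contDiff_cos.comp_contDiffOn hφ2)).congr hA
  have hB2 : ContDiffOn ℝ 2 B K :=
    (contDiffOn_const.mul (Real.contDiff_sin.comp_contDiffOn hφ2)).congr hB
  have hA1 : DifferentiableOn ℝ A K := hA2.differentiableOn (by norm_num)
  have hB1 : DifferentiableOn ℝ B K := hB2.differentiableOn (by norm_num)
  have hdφ (i : Fin 5) : DifferentiableOn ℝ (pd K i φ) K :=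
    (contDiffOn_pd hK hφ (m := 1) (by norm_num) i).differentiableOn (by norm_num)
  have hdA : ∀ i, ∀ y ∈ K, pd K i A y = -(B y * pd K i φ y) := fun i y hy =>
    (pd_of_phase hK hφ1 hA hB i hy).1
  have hdB : ∀ i, ∀ y ∈ K, pd K i B y = A y * pd K i φ y := fun i y hy =>
    (pd_of_phase hK hφ1 hA hB i hy).2
  have hLA : ∀ y ∈ K, lap K A y = -(B y * lap K φ y) - A y * ∑ i, pd K i φ y * pd K i φ y := by
    intro y hy
    simp only [lap, Finset.mul_sum, ← Finset.sum_sub_distrib, ← Finset.sum_neg_distrib]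
    refine Finset.sum_congr rfl fun i _ => ?_
    rw [pd_congr (hdA i) hy, pd_neg hK hy, pd_mul hK hy hB1 (hdφ i), hdB i y hy]
    ring
  have hLB : ∀ y ∈ K, lap K B y = A y * lap K φ y - B y * ∑ i, pd K i φ y * pd K i φ y := by
    intro y hy
    simp only [lap, Finset.mul_sum, ← Finset.sum_sub_distrib]
    refine Finset.sum_congr rfl fun i _ => ?_
    rw [pd_congr (hdB i) hy, pd_mul hK hy hA1 (hdφ i), hdA i y hy]
    ring
  have hWA' : EqOn WA (fun y => -(sphLap K φ y * B y + gradSq K φ y * A y)) K := by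
    intro y hy
    rw [hWA y hy, hLA y hy]
    simp only [sphLap, gradSq]; ring
  have hWB' : EqOn WB (fun y => sphLap K φ y * A y + -(gradSq K φ y * B y)) K := by
    intro y hy
    rw [hWB y hy, hLB y hy]
    simp only [sphLap, gradSq]; ring
  have hs1 (f : E5 → ℝ) : ∑ i, pd K i f x * pd K i A x = -(B x * ∑ i, pd K i f x * pd K i φ x) := by
    rw [Finset.mul_sum, ← Finset.sum_neg_distrib]
    exact Finset.sum_congr rfl fun i _ => by rw [hdA i x hx]; ring
  have hs2 (f : E5 → ℝ) : ∑ i, pd K i f x * pd K i B x = A x * ∑ i, pd K i f x * pd K i φ x := by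
    rw [Finset.mul_sum]
    exact Finset.sum_congr rfl fun i _ => by rw [hdB i x hx]; ring
  rw [lap_congr hWA' hx, lap_congr hWB' hx, lap_neg hK hx, lap_add hK hx (hq.mul hB2) (hp.mul hA2),
    lap_add hK hx (hq.mul hA2) (hp.mul hB2).neg, lap_neg hK hx, lap_mul hK hx hq hB2,
    lap_mul hK hx hp hA2, lap_mul hK hx hq hA2, lap_mul hK hx hp hB2, hs1, hs1, hs2, hs2,
    hLA x hx, hLB x hx] at h
  have hAB : A x ^ 2 + B x ^ 2 = r ^ 2 := by
    rw [hA x hx, hB x hx]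
    linear_combination r ^ 2 * Real.sin_sq_add_cos_sq (φ x)
  -- On the unit sphere the weights `‖x‖²` disappear from values; their derivatives are already
  -- accounted for.
  have hpx : gradSq K φ x = ∑ i, pd K i φ x * pd K i φ x := by simp [gradSq, hx1]
  have hqx : sphLap K φ x = lap K φ x := by simp [sphLap, hx1]
  unfold PhaseEquation
  -- The tested equation is `r² = A² + B²` times the phase equation: `A ∇A + B ∇B = 0` removes the
  -- `∇q` terms, and the terms in the Laplacian of `gradSq` cancel.
  refine (mul_eq_zero.1 ?_).resolve_left (pow_pos hr 2).ne'
  rw [← hAB]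
  rw [hqx, ← hpx] at h
  linear_combination h

end phase

/-! ### Existence and regularity of the phase -/

/-- The closed upper halfspace without the origin. -/
def upperHalf : Set E5 := {x | x ≠ 0 ∧ 0 ≤ x 4}

/-- The difference of two phases is continuous with values in the discrete group `2πℤ`, hence
constant on a preconnected set. -/
theorem exists_int_of_cos_sin_eq {S : Set E5} (hS : IsPreconnected S) {φ ψ : E5 → ℝ}
    (hφ : ContinuousOn φ S) (hψ : ContinuousOn ψ S)
    (hc : ∀ x ∈ S, Real.cos (φ x) = Real.cos (ψ x))
    (hs : ∀ x ∈ S, Real.sin (φ x) = Real.sin (ψ x)) :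
    ∃ k : ℤ, ∀ x ∈ S, φ x = ψ x + 2 * Real.pi * k := by
  have hmaps : MapsTo (fun x => φ x - ψ x) S (AddSubgroup.zmultiples (2 * Real.pi)) := by
    intro x hx
    obtain ⟨k, hk⟩ := Real.Angle.angle_eq_iff_two_pi_dvd_sub.1
      (Real.Angle.cos_sin_inj (hc x hx) (hs x hx))
    exact ⟨k, by simp [hk, mul_comm]⟩
  obtain ⟨_, ⟨k, rfl⟩, hk⟩ := hS.eqOn_const_of_mapsTo
    (isDiscrete_iff_discreteTopology.2
      (inferInstanceAs (DiscreteTopology (AddSubgroup.zmultiples (2 * Real.pi)))))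
    (hφ.fun_sub hψ) hmaps ⟨0, zero_mem _⟩
  refine ⟨k, fun x hx => ?_⟩
  have h := hk hx
  simp only [Function.const_apply, zsmul_eq_mul] at h
  linear_combination h

theorem isPreconnected_equatorialCone : IsPreconnected {x : E5 | x ≠ 0 ∧ x 4 = 0} := by
  have h1 : IsPreconnected ({0}ᶜ : Set (Fin 4 → ℝ)) :=
    (isConnected_compl_singleton_of_one_lt_rank (by simp) 0).isPreconnected
  let f : (Fin 4 → ℝ) → E5 := fun w => WithLp.toLp 2 ![w 0, w 1, w 2, w 3, 0]
  have hf : Continuous f := by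
    refine (PiLp.continuous_toLp 2 _).comp (continuous_pi fun i => ?_)
    fin_cases i <;> simp <;> fun_prop
  have h2 := h1.image f hf.continuousOn
  convert h2 using 1
  ext x
  constructor
  · rintro ⟨h0, h4⟩
    refine ⟨![x 0, x 1, x 2, x 3], ?_, ?_⟩
    · intro h
      refine h0 ?_
      have e0 := congrFun h 0
      have e1 := congrFun h 1
      have e2 := congrFun h 2
      have e3 := congrFun h 3
      ext i
      fin_cases i <;> simp_all
    · ext i
      fin_cases i <;> simp [f, h4]
  · rintro ⟨w, hw, rfl⟩
    refine ⟨fun h => hw ?_, by simp [f]⟩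
    have e0 := congrArg (fun x : E5 => x 0) h
    have e1 := congrArg (fun x : E5 => x 1) h
    have e2 := congrArg (fun x : E5 => x 2) h
    have e3 := congrArg (fun x : E5 => x 3) h
    ext i
    fin_cases i <;> simp_all [f]

/-- A degree-zero homogeneous map of the upper halfspace to a circle has a continuous phase. -/
theorem exists_phase_upperHalf {r : ℝ} (hr : 0 < r) {A B : E5 → ℝ}
    (hA : ContinuousOn A upperHalf) (hB : ContinuousOn B upperHalf)
    (hAB : ∀ x ∈ upperHalf, A x ^ 2 + B x ^ 2 = r ^ 2)
    (hAh : ∀ x ∈ upperHalf, ∀ t : ℝ, 0 < t → A (t • x) = A x)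
    (hBh : ∀ x ∈ upperHalf, ∀ t : ℝ, 0 < t → B (t • x) = B x) :
    ∃ φ : E5 → ℝ, ContinuousOn φ upperHalf ∧
      ∀ x ∈ upperHalf, A x = r * Real.cos (φ x) ∧ B x = r * Real.sin (φ x) := by
  -- `T` projects onto the equatorial hyperplane, and `s` lifts it to the graph of `max 0 (1 - ‖T
  -- y‖)`, a tent that avoids the origin. Thus `(A, B) ∘ s` is defined on all of `ℝ⁵`, where lifting
  -- through `Circle.exp` is unobstructed. Scaling `x` by `(‖T x‖ + x 4)⁻¹` lands on the tent, where
  -- `s` is the identity, so homogeneity recovers `(A, B)` at `x`.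
  let e : E5 := EuclideanSpace.single 4 1
  let T : E5 → E5 := fun y => y - y 4 • e
  let s : E5 → E5 := fun y => T y + max 0 (1 - ‖T y‖) • e
  have hT : Continuous T := by fun_prop
  have hs : Continuous s := by fun_prop
  have hT4 : ∀ y, T y 4 = 0 := by intro y; simp [T, e]
  have hs4 : ∀ y, s y 4 = max 0 (1 - ‖T y‖) := by intro y; simp [s, hT4, e]
  have hsm : ∀ y, s y ∈ upperHalf := by
    refine fun y => ⟨fun h0 => ?_, (hs4 y).symm ▸ le_max_left _ _⟩
    have h4 := hs4 y
    rw [h0] at h4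
    have h5 : max 0 (1 - ‖T y‖) = 0 := by simpa using h4.symm
    have h6 : T y = 0 := by simpa [s, h5] using h0
    rw [h6] at h5
    simp at h5
  let z : E5 → ℂ := fun y => ((A (s y) / r : ℝ) : ℂ) + ((B (s y) / r : ℝ) : ℂ) * Complex.I
  have hz : Continuous z :=
    (Complex.continuous_ofReal.comp ((hA.comp_continuous hs hsm).div_const r)).add
      ((Complex.continuous_ofReal.comp ((hB.comp_continuous hs hsm).div_const r)).mul
        continuous_const)
  have hz1 : ∀ y, z y ∈ sphere (0 : ℂ) 1 := by
    intro y
    rw [mem_sphere_zero_iff_norm, ← sq_eq_sq₀ (norm_nonneg _) zero_le_one, Complex.sq_norm,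
      Complex.normSq_add_mul_I, div_pow, div_pow, ← add_div, hAB _ (hsm y), one_pow,
      div_self (pow_pos hr 2).ne']
  let f : C(E5, Circle) := ⟨fun y => ⟨z y, hz1 y⟩, hz.subtype_mk hz1⟩
  obtain ⟨φ, ⟨-, hφ⟩, -⟩ := Circle.isCoveringMap_exp.existsUnique_continuousMap_lifts f 0
    (Complex.arg (f 0)) (Circle.exp_arg _)
  have hφ' : ∀ y, A (s y) = r * Real.cos (φ y) ∧ B (s y) = r * Real.sin (φ y) := by
    intro y
    have h1 : (Circle.exp (φ y) : ℂ) = z y :=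
      congrArg Subtype.val (congrFun hφ y)
    rw [Circle.coe_exp, Complex.exp_mul_I, ← Complex.ofReal_cos, ← Complex.ofReal_sin] at h1
    have h2 := congrArg Complex.re h1
    have h3 := congrArg Complex.im h1
    simp [z, -Complex.ofReal_cos, -Complex.ofReal_sin] at h2 h3
    constructor
    · rw [h2]; field_simp
    · rw [h3]; field_simp
  have hd : ∀ x ∈ upperHalf, 0 < ‖T x‖ + x 4 := by
    intro x hx
    rcases hx.2.lt_or_eq with h | h
    · positivity
    · rw [← h, add_zero, norm_pos_iff]
      simpa [T, ← h] using hx.1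
  have hsx : ∀ x ∈ upperHalf, s ((‖T x‖ + x 4)⁻¹ • x) = (‖T x‖ + x 4)⁻¹ • x := by
    intro x hx
    have hp := hd x hx
    set d := ‖T x‖ + x 4 with hdd
    have h1 : T (d⁻¹ • x) = d⁻¹ • T x := by simp [T, smul_sub, smul_smul]
    have h2 : 1 - ‖T (d⁻¹ • x)‖ = d⁻¹ * x 4 := by
      rw [h1, norm_smul, norm_inv, Real.norm_of_nonneg hp.le]
      field_simp
      linarith
    have h3 : max 0 (1 - ‖T (d⁻¹ • x)‖) = d⁻¹ * x 4 := by
      rw [h2]; exact max_eq_right (mul_nonneg (inv_nonneg.2 hp.le) hx.2)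
    simp only [s, h3]
    simp [T]
  refine ⟨fun x => φ ((‖T x‖ + x 4)⁻¹ • x), ?_, fun x hx => ?_⟩
  · refine φ.continuous.comp_continuousOn (ContinuousOn.smul (ContinuousOn.inv₀ ?_ fun x hx =>
      (hd x hx).ne') continuousOn_id)
    fun_prop
  · have := hφ' ((‖T x‖ + x 4)⁻¹ • x)
    rw [hsx x hx, hAh x hx _ (inv_pos.2 (hd x hx)), hBh x hx _ (inv_pos.2 (hd x hx))] at this
    exact this

/-- A degree-zero homogeneous map of the punctured space to a circle has a continuous phase. -/
theorem exists_phase_compl_zero {r : ℝ} (hr : 0 < r) {A B : E5 → ℝ}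
    (hA : ContinuousOn A {0}ᶜ) (hB : ContinuousOn B {0}ᶜ)
    (hAB : ∀ x ∈ ({0}ᶜ : Set E5), A x ^ 2 + B x ^ 2 = r ^ 2)
    (hAh : ∀ x ∈ ({0}ᶜ : Set E5), ∀ t : ℝ, 0 < t → A (t • x) = A x)
    (hBh : ∀ x ∈ ({0}ᶜ : Set E5), ∀ t : ℝ, 0 < t → B (t • x) = B x) :
    ∃ φ : E5 → ℝ, ContinuousOn φ {0}ᶜ ∧
      ∀ x ∈ ({0}ᶜ : Set E5), A x = r * Real.cos (φ x) ∧ B x = r * Real.sin (φ x) := by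
  -- Reflection in the equatorial hyperplane: the lower half gets its phase from the upper half, and
  -- the two are glued after a shift by `2πk` that makes them agree on the equatorial cone.
  let R : E5 → E5 := fun x => x - (2 * x 4) • EuclideanSpace.single 4 1
  have hR : Continuous R := by fun_prop
  have hR4 : ∀ x, R x 4 = -x 4 := by intro x; simp [R]; ring
  have hRR : ∀ x, R (R x) = x := by
    intro x
    have h : R (R x) = R x - (2 * R x 4) • EuclideanSpace.single 4 1 := rfl
    rw [h, hR4]
    simp [R]
  have hR0 : ∀ x, x ≠ 0 → R x ≠ 0 := by
    intro x hx h
    refine hx ?_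
    rw [← hRR x, h]
    simp [R]
  have hRs : ∀ x (t : ℝ), R (t • x) = t • R x := by
    intro x t; simp [R, smul_sub, smul_smul]; ring_nf
  have hsub : upperHalf ⊆ {0}ᶜ := fun x hx => hx.1
  have hmapR : MapsTo R upperHalf {0}ᶜ := fun x hx => hR0 x hx.1
  obtain ⟨φ, hφ, hφe⟩ := exists_phase_upperHalf hr (hA.mono hsub) (hB.mono hsub)
    (fun x hx => hAB x hx.1) (fun x hx => hAh x hx.1) (fun x hx => hBh x hx.1)
  obtain ⟨ψ, hψ, hψe⟩ := exists_phase_upperHalf hr (A := A ∘ R) (B := B ∘ R)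
    (hA.comp hR.continuousOn hmapR) (hB.comp hR.continuousOn hmapR)
    (fun x hx => hAB _ (hmapR hx))
    (fun x hx t ht => by simp only [Function.comp, hRs]; exact hAh _ (hmapR hx) t ht)
    (fun x hx t ht => by simp only [Function.comp, hRs]; exact hBh _ (hmapR hx) t ht)
  have hψR : ∀ x, x ≠ 0 → x 4 ≤ 0 →
      A x = r * Real.cos (ψ (R x)) ∧ B x = r * Real.sin (ψ (R x)) := by
    intro x hx hx4
    have := hψe (R x) ⟨hR0 x hx, by rw [hR4]; linarith⟩
    simpa only [Function.comp, hRR] using this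
  have hψc : ContinuousOn (fun x => ψ (R x)) {x | x ≠ 0 ∧ x 4 ≤ 0} :=
    hψ.comp hR.continuousOn fun x hx => ⟨hR0 x hx.1, by rw [hR4]; linarith [hx.2]⟩
  obtain ⟨k, hk⟩ := exists_int_of_cos_sin_eq isPreconnected_equatorialCone (φ := φ)
    (ψ := fun x => ψ (R x)) (hφ.mono fun x hx => ⟨hx.1, hx.2.ge⟩)
    (hψc.mono fun x hx => ⟨hx.1, hx.2.le⟩)
    (fun x hx => mul_left_cancel₀ hr.ne'
      ((hφe x ⟨hx.1, hx.2.ge⟩).1.symm.trans (hψR x hx.1 hx.2.le).1))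
    (fun x hx => mul_left_cancel₀ hr.ne'
      ((hφe x ⟨hx.1, hx.2.ge⟩).2.symm.trans (hψR x hx.1 hx.2.le).2))
  classical
  refine ⟨fun x => if 0 ≤ x 4 then φ x else ψ (R x) + 2 * Real.pi * k, ?_, fun x hx => ?_⟩
  · have hU : ({0}ᶜ : Set E5) = upperHalf ∪ {x | x ≠ 0 ∧ x 4 ≤ 0} := by
      ext x
      simp only [upperHalf, mem_compl_iff, mem_singleton_iff, mem_union, mem_ofPred_eq]
      rcases le_total 0 (x 4) with h | h <;> tauto
    have hc4 : Continuous fun x : E5 => x 4 := by fun_prop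
    have h1 : ContinuousOn (fun x : E5 => if 0 ≤ x 4 then φ x else ψ (R x) + 2 * Real.pi * k)
        upperHalf := hφ.congr fun x hx => if_pos hx.2
    have h2 : ContinuousOn (fun x : E5 => if 0 ≤ x 4 then φ x else ψ (R x) + 2 * Real.pi * k)
        {x | x ≠ 0 ∧ x 4 ≤ 0} := by
      refine (hψc.fun_add (continuousOn_const (c := 2 * Real.pi * k))).congr fun x hx => ?_
      by_cases h : 0 ≤ x 4
      · rw [if_pos h, hk x ⟨hx.1, le_antisymm hx.2 h⟩]
      · rw [if_neg h]
    intro x hx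
    rw [hU]
    refine ContinuousWithinAt.union ?_ ?_
    · by_cases h : 0 ≤ x 4
      · exact h1 x ⟨hx, h⟩
      · refine continuousWithinAt_of_notMem_closure fun hcl => h ?_
        exact closure_minimal (fun y hy => hy.2) (isClosed_le continuous_const hc4) hcl
    · by_cases h : x 4 ≤ 0
      · exact h2 x ⟨hx, h⟩
      · refine continuousWithinAt_of_notMem_closure fun hcl => h ?_
        exact closure_minimal (fun y hy => hy.2) (isClosed_le hc4 continuous_const) hcl
  · by_cases h : 0 ≤ x 4
    · simpa only [if_pos h] using hφe x ⟨hx, h⟩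
    · simp only [if_neg h]
      have h3 : 2 * Real.pi * k = k * (2 * Real.pi) := mul_comm _ _
      rw [h3, Real.cos_add_int_mul_two_pi, Real.sin_add_int_mul_two_pi]
      exact hψR x hx (le_of_not_ge h)

/-- A continuous phase inherits the regularity of the map. -/
theorem contDiffOn_phase {K : Set E5} {r : ℝ} (hr : 0 < r) {A B φ : E5 → ℝ} {n : ℕ∞ω}
    (hA : ContDiffOn ℝ n A K) (hB : ContDiffOn ℝ n B K) (hφ : ContinuousOn φ K)
    (hφA : ∀ x ∈ K, A x = r * Real.cos (φ x)) (hφB : ∀ x ∈ K, B x = r * Real.sin (φ x)) :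
    ContDiffOn ℝ n φ K := by
  intro x hx
  -- This is `sin (φ y - φ x)` expressed through `A` and `B`. Near `x` the difference of phases is
  -- below `π / 2`, so `arcsin` recovers it smoothly.
  let g : E5 → ℝ := fun y => (B y * A x - A y * B x) / r ^ 2
  have hg : ContDiffWithinAt ℝ n g K x :=
    (((hB x hx).mul contDiffWithinAt_const).sub ((hA x hx).mul contDiffWithinAt_const)).div_const _
  have hgx : g x = 0 := by simp [g, mul_comm]
  have hsin : ∀ y ∈ K, Real.sin (φ y - φ x) = g y := by
    intro y hy
    simp only [g, hφA y hy, hφB y hy, hφA x hx, hφB x hx, Real.sin_sub]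
    field_simp
  have harc : ContDiffWithinAt ℝ n (fun y => φ x + Real.arcsin (g y)) K x :=
    contDiffWithinAt_const.add ((Real.contDiffAt_arcsin (by rw [hgx]; norm_num)
      (by rw [hgx]; norm_num)).comp_contDiffWithinAt x hg)
  have hev : ∀ y ∈ K, |φ y - φ x| < Real.pi / 2 → φ y = φ x + Real.arcsin (g y) := by
    intro y hy h
    rw [abs_lt] at h
    rw [← hsin y hy, Real.arcsin_sin (by linarith [h.1]) (by linarith [h.2])]
    ring
  refine harc.congr_of_eventuallyEq ?_ (hev x hx (by simpa using Real.pi_div_two_pos))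
  have h1 : ∀ᶠ y in nhdsWithin x K, |φ y - φ x| < Real.pi / 2 := by
    have := (hφ x hx).eventually (Metric.ball_mem_nhds (φ x) Real.pi_div_two_pos)
    simpa [Real.dist_eq] using this
  filter_upwards [h1, self_mem_nhdsWithin] with y hy1 hy2 using hev y hy2 hy1

/-! ### The degree-zero extension of a map on the sphere -/

theorem coe_radialProj {x : E5} (hx : x ≠ 0) : (radialProj x : E5) = ‖x‖⁻¹ • x := by
  simp [radialProj, hx]

theorem radialProj_smul {x : E5} (hx : x ≠ 0) {t : ℝ} (ht : 0 < t) :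
    radialProj (t • x) = radialProj x := by
  apply Subtype.ext
  rw [coe_radialProj hx, coe_radialProj (smul_ne_zero ht.ne' hx), norm_smul,
    Real.norm_of_nonneg ht.le, smul_smul]
  congr 1
  field_simp

theorem coe_sphere_ne_zero (x : S4) : (x : E5) ≠ 0 := ne_zero_of_mem_unit_sphere x

theorem radialProj_coe (x : S4) : radialProj x = x := by
  apply Subtype.ext
  rw [coe_radialProj (coe_sphere_ne_zero x), norm_eq_of_mem_sphere x, inv_one, one_smul]

theorem cone_univ : cone univ = {0}ᶜ := by
  ext x; simp [cone]

theorem cone_halfSphere : cone halfSphere = upperHalf := by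
  ext x
  refine and_congr_right fun hx => ?_
  have hn : 0 < ‖x‖⁻¹ := inv_pos.2 (norm_pos_iff.2 hx)
  change 0 ≤ (radialProj x : E5) 4 ↔ _
  rw [coe_radialProj hx]
  simp [hn]

theorem smul_mem_cone {M : Set S4} {x : E5} (hx : x ∈ cone M) {t : ℝ} (ht : 0 < t) :
    t • x ∈ cone M :=
  ⟨smul_ne_zero ht.ne' hx.1, by rw [radialProj_smul hx.1 ht]; exact hx.2⟩

theorem coe_mem_cone {M : Set S4} {x : S4} (hx : x ∈ M) : (x : E5) ∈ cone M :=
  ⟨coe_sphere_ne_zero x, by rwa [radialProj_coe]⟩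

theorem contMDiffAt_radialProj {x : E5} (hx : x ≠ 0) {n : ℕ∞ω} :
    ContMDiffAt 𝓘(ℝ, E5) (𝓡 4) n radialProj x := by
  let U : TopologicalSpace.Opens E5 := ⟨{0}ᶜ, isOpen_compl_singleton⟩
  have h1 : ContMDiff 𝓘(ℝ, E5) 𝓘(ℝ, E5) n (fun y : U => ‖(y : E5)‖⁻¹ • (y : E5)) := by
    intro y
    have hy : (y : E5) ≠ 0 := y.2
    have h2 : ContDiffAt ℝ n (fun y : E5 => ‖y‖⁻¹ • y) (y : E5) :=
      ((contDiffAt_norm ℝ hy).inv (norm_ne_zero_iff.2 hy)).smul contDiffAt_id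
    exact contMDiffAt_subtype_iff.2 h2.contMDiffAt
  have : Fact (finrank ℝ E5 = 4 + 1) := ⟨finrank_euclideanSpace_fin⟩
  have h3 := h1.codRestrict_sphere (n := 4) (fun y => by
    have hy : (y : E5) ≠ 0 := y.2
    rw [mem_sphere_zero_iff_norm, norm_smul, norm_inv, norm_norm,
      inv_mul_cancel₀ (norm_ne_zero_iff.2 hy)])
  have h4 : ContMDiff 𝓘(ℝ, E5) (𝓡 4) n (fun y : U => radialProj y) := by
    refine h3.congr fun y => Subtype.ext ?_
    have hy : (y : E5) ≠ 0 := y.2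
    rw [coe_radialProj hy]
    rfl
  exact contMDiffAt_subtype_iff.1 (h4 ⟨x, hx⟩)

theorem uniqueDiffOn_upperHalf : UniqueDiffOn ℝ upperHalf := by
  have hc : Convex ℝ {x : E5 | 0 ≤ x 4} := by
    intro x hx y hy a b ha hb _
    have hx' : 0 ≤ x 4 := hx
    have hy' : 0 ≤ y 4 := hy
    change 0 ≤ (a • x + b • y) 4
    simp only [PiLp.add_apply, PiLp.smul_apply, smul_eq_mul]
    positivity
  have ho : IsOpen {x : E5 | 0 < x 4} := isOpen_lt continuous_const (by fun_prop)
  have hi : (interior {x : E5 | 0 ≤ x 4}).Nonempty :=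
    ⟨EuclideanSpace.single 4 1, interior_maximal (s := {x : E5 | 0 ≤ x 4})
      (t := {x : E5 | 0 < x 4}) (fun x (hx : 0 < x 4) => hx.le) ho (by simp)⟩
  have h : upperHalf = {x : E5 | 0 ≤ x 4} ∩ {0}ᶜ := by
    ext x; exact and_comm
  rw [h]
  exact (uniqueDiffOn_convex hc hi).inter isOpen_compl_singleton

section extension

variable {F : Type*} [NormedAddCommGroup F] [InnerProductSpace ℝ F] {M : Set S4} {u : S4 → F}

theorem contDiffOn_extension {n : ℕ∞ω} (hu : ContMDiffOn (𝓡 4) 𝓘(ℝ, F) n u M) :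
    ContDiffOn ℝ n (fun y : E5 => u (radialProj y)) (cone M) :=
  contMDiffOn_iff_contDiffOn.1 (hu.comp
    (fun _ hx => (contMDiffAt_radialProj hx.1).contMDiffWithinAt) fun _ hx => hx.2)

theorem fderivWithin_extension_eq_zero (hK : UniqueDiffOn ℝ (cone M))
    (hu : ContMDiffOn (𝓡 4) 𝓘(ℝ, F) 4 u M) {x : E5} (hx : x ∈ cone M)
    (h0 : mfderivWithin (𝓡 4) 𝓘(ℝ, F) u M (radialProj x) = 0) :
    fderivWithin ℝ (fun y : E5 => u (radialProj y)) (cone M) x = 0 := by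
  have h1 := ((hu _ hx.2).mdifferentiableWithinAt (by norm_num)).hasMFDerivWithinAt
  rw [h0] at h1
  have h2 := ((contMDiffAt_radialProj hx.1 (n := 1)).mdifferentiableAt
    (by norm_num)).hasMFDerivAt.hasMFDerivWithinAt (s := cone M)
  have h3 := (h1.comp x h2 fun y hy => hy.2).hasFDerivWithinAt
  have h4 : HasFDerivWithinAt (fun y : E5 => u (radialProj y)) (0 : E5 →L[ℝ] F) (cone M) x := h3
  exact h4.fderivWithin (hK x hx)

end extension

/-! ### Maps into the flat torus -/

section torus

variable {n : ℕ} {r : Fin n → ℝ} {M : Set S4}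
  {u : S4 → EuclideanSpace ℝ (Fin n × Fin 2)}

theorem laplacianWithin_apply {ι : Type*} [Fintype ι] {K : Set E5} (hK : UniqueDiffOn ℝ K)
    {V : E5 → EuclideanSpace ℝ ι} (hV : ContDiffOn ℝ 2 V K) {x : E5} (hx : x ∈ K) (j : ι) :
    InnerProductSpace.laplacianWithin V K x j = lap K (fun y => V y j) x := by
  rw [← laplacianWithin_eq_lap hK hx (contDiffOn_euclidean.1 hV j)]
  exact ((hV x hx).laplacianWithin_CLM_comp_left (l := EuclideanSpace.proj (𝕜 := ℝ) j) hK hx).symm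

/-- The rotation field of the `i`-th circle is tangent to the torus. -/
theorem rotation_mem_tangentVectors {p : EuclideanSpace ℝ (Fin n × Fin 2)} (hp : p ∈ flatTorus r)
    (i : Fin n) : (-p (i, 1)) • EuclideanSpace.single (i, (0 : Fin 2)) (1 : ℝ) +
      p (i, 0) • EuclideanSpace.single (i, (1 : Fin 2)) (1 : ℝ) ∈
        tangentVectors (flatTorus r) p := by
  -- Rotation by the angle `t` in the `i`-th plane, written as `p` plus an increment.
  refine ⟨fun t => p +
    ((p (i, 0) * (Real.cos t - 1) - p (i, 1) * Real.sin t) •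
        EuclideanSpace.single (i, (0 : Fin 2)) (1 : ℝ) +
      (p (i, 0) * Real.sin t + p (i, 1) * (Real.cos t - 1)) •
        EuclideanSpace.single (i, (1 : Fin 2)) (1 : ℝ)), ?_, ?_, ?_, ?_⟩
  · have hc : ContDiff ℝ ∞ Real.cos := Real.contDiff_cos
    have hs : ContDiff ℝ ∞ Real.sin := Real.contDiff_sin
    fun_prop
  · intro t j
    have hj := hp j
    by_cases hij : j = i
    · subst hij
      simp
      linear_combination hj + (p (j, 0) ^ 2 + p (j, 1) ^ 2) * Real.sin_sq_add_cos_sq t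
    · simpa [hij] using hj
  · simp
  · have h1 : HasDerivAt (fun t => p (i, 0) * (Real.cos t - 1) - p (i, 1) * Real.sin t)
        (-p (i, 1)) 0 := by
      have := (((Real.hasDerivAt_cos 0).sub_const 1).const_mul (p (i, 0))).fun_sub
        ((Real.hasDerivAt_sin 0).const_mul (p (i, 1)))
      simpa using this
    have h2 : HasDerivAt (fun t => p (i, 0) * Real.sin t + p (i, 1) * (Real.cos t - 1))
        (p (i, 0)) 0 := by
      have := ((Real.hasDerivAt_sin 0).const_mul (p (i, 0))).fun_add
        (((Real.hasDerivAt_cos 0).sub_const 1).const_mul (p (i, 1)))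
      simpa using this
    exact ((h1.smul_const _).add (h2.smul_const _)).const_add _

/-- The phases of a Paneitz-biharmonic map into the flat torus satisfy the phase equation. -/
theorem IsPaneitzBiharmonicOn.phaseEquation (hK : UniqueDiffOn ℝ (cone M))
    (hu : IsPaneitzBiharmonicOn M (flatTorus r) u) (i : Fin n) (hr : 0 < r i) {φ : E5 → ℝ}
    (hφ : ContDiffOn ℝ 4 φ (cone M))
    (hA : ∀ y ∈ cone M, u (radialProj y) (i, 0) = r i * Real.cos (φ y))
    (hB : ∀ y ∈ cone M, u (radialProj y) (i, 1) = r i * Real.sin (φ y))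
    {x : E5} (hx : x ∈ cone M) (hx1 : ‖x‖ = 1) : PhaseEquation (cone M) φ x := by
  have hU := contDiffOn_extension hu.contMDiffOn
  have hU2 : ContDiffOn ℝ 2 (fun y : E5 => u (radialProj y)) (cone M) := hU.of_le (by norm_num)
  have hUj : ∀ j, ContDiffOn ℝ 4 (fun y : E5 => u (radialProj y) j) (cone M) :=
    contDiffOn_euclidean.1 hU
  have hW : ∀ j, ∀ y ∈ cone M, laplaceBeltrami M u (radialProj y) j =
      ‖y‖ ^ 2 * lap (cone M) (fun y : E5 => u (radialProj y) j) y := by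
    intro j y hy
    have hn : 0 < ‖y‖ := norm_pos_iff.2 hy.1
    have hy' : (radialProj y : E5) ∈ cone M := coe_mem_cone hy.2
    have h1 := lap_smul hK (fun z hz t ht => smul_mem_cone hz ht)
      ((hUj j).of_le (by norm_num)) (fun z hz t ht => by rw [radialProj_smul hz.1 ht]) _ hy' _ hn
    rw [laplaceBeltrami, laplacianWithin_apply hK hU2 hy', ← h1, coe_radialProj hy.1, smul_smul,
      mul_inv_cancel₀ hn.ne', one_smul]
  have hW2 : ContDiffOn ℝ 2 (fun y : E5 => laplaceBeltrami M u (radialProj y)) (cone M) := by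
    refine contDiffOn_euclidean.2 fun j => ContDiffOn.congr ?_ (hW j)
    exact (contDiff_norm_sq ℝ).contDiffOn.mul (contDiffOn_lap hK (hUj j) (by norm_num))
  have hxM : radialProj x ∈ M := hx.2
  have hxx : (radialProj x : E5) = x := by rw [coe_radialProj hx.1, hx1, inv_one, one_smul]
  have hP : ∀ j, paneitzOp M u (radialProj x) j =
      lap (cone M) (fun y : E5 => laplaceBeltrami M u (radialProj y) j) x
        - 2 * lap (cone M) (fun y : E5 => u (radialProj y) j) x := by
    intro j
    rw [paneitzOp, PiLp.sub_apply, PiLp.smul_apply, smul_eq_mul, laplaceBeltrami, hxx,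
      laplacianWithin_apply hK hW2 hx, laplaceBeltrami, hxx, laplacianWithin_apply hK hU2 hx]
  have horth := hu.orthogonal _ hxM _ (rotation_mem_tangentVectors (hu.mapsTo hxM) i)
  -- What remains is the pairing of the Paneitz operator with the rotation vector `(-B, A)`.
  refine phaseEquation_of_paneitz hK hφ hr hA hB (hW (i, 0)) (hW (i, 1)) hx hx1 ?_
  rw [inner_add_right, inner_smul_right, inner_smul_right, EuclideanSpace.inner_single_right,
    EuclideanSpace.inner_single_right] at horth
  simp only [hP] at horth
  simp at horth
  linear_combination horth

/-- The phases of a Paneitz-biharmonic map into the flat torus are locally constant in the interior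
of the domain. -/
theorem IsPaneitzBiharmonicOn.fderiv_phase_eq_zero (hK : UniqueDiffOn ℝ (cone M))
    (hu : IsPaneitzBiharmonicOn M (flatTorus r) u) (i : Fin n) (hr : 0 < r i)
    {b : ℝ} (hb : b < 2) (hbox : ∀ x : E5, b ≤ x 4 → x ≠ 0 → x ∈ cone M)
    {φ : E5 → ℝ} (hφ : ContDiffOn ℝ 4 φ (cone M))
    (hhom : ∀ y ∈ cone M, ∀ t : ℝ, 0 < t → φ (t • y) = φ y)
    (hA : ∀ y ∈ cone M, u (radialProj y) (i, 0) = r i * Real.cos (φ y))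
    (hB : ∀ y ∈ cone M, u (radialProj y) (i, 1) = r i * Real.sin (φ y)) {c : ℝ}
    (hbd : ∀ x ∈ cone M, x 4 = b → 3 ≤ ‖x‖ ^ 2 ∨ (φ x = c ∧ pd (cone M) 4 φ x = 0))
    {x : E5} (hx : cone M ∈ nhds x) {t : ℝ} (ht : 0 < t) (htx : ‖t • x‖ ^ 2 = 2)
    (hxb : b < (t • x) 4) : fderiv ℝ φ x = 0 := by
  have hxK : x ∈ cone M := mem_of_mem_nhds hx
  have h1 : ∀ j, pd (cone M) j φ x = 0 := by
    intro j
    rw [← pd_smul_of_homogeneous hK (fun z hz t ht => smul_mem_cone hz ht)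
      (hφ.differentiableOn (by norm_num)) hhom j x hxK t ht,
      pd_eq_zero_of_phaseEquation hK (fun z hz t ht => smul_mem_cone hz ht) (fun y hy => hy.1) hb
        hbox hφ hhom (fun y hy hy1 => hu.phaseEquation hK i hr hφ hA hB hy hy1) hbd htx hxb,
      mul_zero]
  rw [← fderivWithin_of_mem_nhds hx]
  apply ContinuousLinearMap.coe_injective
  refine (EuclideanSpace.basisFun (Fin 5) ℝ).toBasis.ext fun i => ?_
  simpa [pd] using h1 i

theorem exists_scale {x : E5} (hx : x ≠ 0) : ∃ t : ℝ, 0 < t ∧ ‖t • x‖ ^ 2 = 2 := by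
  have hn : 0 < ‖x‖ := norm_pos_iff.2 hx
  refine ⟨Real.sqrt 2 / ‖x‖, by positivity, ?_⟩
  rw [norm_smul, Real.norm_of_nonneg (by positivity), div_mul_cancel₀ _ hn.ne',
    Real.sq_sqrt zero_le_two]

end torus

/-! ### Liouville theorems for the flat torus -/

section liouville

variable {n : ℕ} {r : Fin n → ℝ} {M : Set S4} {u : S4 → EuclideanSpace ℝ (Fin n × Fin 2)}

theorem contDiffOn_component (hu : IsPaneitzBiharmonicOn M (flatTorus r) u) (j : Fin n × Fin 2) :
    ContDiffOn ℝ 4 (fun y : E5 => u (radialProj y) j) (cone M) :=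
  contDiffOn_euclidean.1 (contDiffOn_extension hu.contMDiffOn) j

theorem component_smul {y : E5} (hy : y ≠ 0) {t : ℝ} (ht : 0 < t) (j : Fin n × Fin 2) :
    u (radialProj (t • y)) j = u (radialProj y) j := by rw [radialProj_smul hy ht]

/-- A continuous phase may be chosen homogeneous of degree zero, and it is then smooth. -/
theorem exists_contDiffOn_phase (hu : IsPaneitzBiharmonicOn M (flatTorus r) u) (i : Fin n)
    (hr : 0 < r i) (h : ∃ φ : E5 → ℝ, ContinuousOn φ (cone M) ∧ ∀ x ∈ cone M,
      u (radialProj x) (i, 0) = r i * Real.cos (φ x) ∧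
        u (radialProj x) (i, 1) = r i * Real.sin (φ x)) :
    ∃ φ : E5 → ℝ, ContDiffOn ℝ 4 φ (cone M) ∧
      (∀ y ∈ cone M, ∀ t : ℝ, 0 < t → φ (t • y) = φ y) ∧
      (∀ x ∈ cone M, u (radialProj x) (i, 0) = r i * Real.cos (φ x)) ∧
        ∀ x ∈ cone M, u (radialProj x) (i, 1) = r i * Real.sin (φ x) := by
  obtain ⟨φ, hφ, hφe⟩ := h
  have hm : ∀ x ∈ cone M, (radialProj x : E5) ∈ cone M := fun x hx => coe_mem_cone hx.2
  have hc : ContinuousOn (fun x : E5 => (radialProj x : E5)) (cone M) := by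
    intro x hx
    exact continuous_subtype_val.continuousAt.comp_continuousWithinAt
      (contMDiffAt_radialProj hx.1 (n := 0)).continuousAt.continuousWithinAt
  have hA : ∀ x ∈ cone M, u (radialProj x) (i, 0) = r i * Real.cos (φ (radialProj x)) ∧
      u (radialProj x) (i, 1) = r i * Real.sin (φ (radialProj x)) := by
    intro x hx
    have := hφe _ (hm x hx)
    rwa [radialProj_coe] at this
  -- Restricting the phase to the sphere and extending it back makes it homogeneous of degree zero.
  refine ⟨fun x => φ (radialProj x), ?_, ?_, fun x hx => (hA x hx).1, fun x hx => (hA x hx).2⟩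
  · exact contDiffOn_phase hr (contDiffOn_component hu (i, 0)) (contDiffOn_component hu (i, 1))
      (hφ.comp hc hm) (fun x hx => (hA x hx).1) fun x hx => (hA x hx).2
  · intro y hy t ht
    simp only [radialProj_smul hy.1 ht]

theorem carriesNoSphere_flatTorus (hr : ∀ i, 0 < r i) : CarriesNoSphere (flatTorus r) := by
  intro u hu
  have hK : UniqueDiffOn ℝ (cone univ) := by
    rw [cone_univ]; exact isOpen_compl_singleton.uniqueDiffOn
  have hmem : ∀ x : E5, x ∈ cone univ ↔ x ≠ 0 := by intro x; rw [cone_univ]; rfl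
  have hnhds : ∀ x : E5, x ≠ 0 → cone univ ∈ nhds x := by
    intro x hx; rw [cone_univ]; exact isOpen_compl_singleton.mem_nhds hx
  have hphase : ∀ i, ∃ a : ℝ, ∀ x ∈ cone univ,
      u (radialProj x) (i, 0) = r i * Real.cos a ∧ u (radialProj x) (i, 1) = r i * Real.sin a := by
    intro i
    have hc := exists_phase_compl_zero (hr i) (A := fun y => u (radialProj y) (i, 0))
      (B := fun y => u (radialProj y) (i, 1))
      (cone_univ ▸ (contDiffOn_component hu (i, 0)).continuousOn)
      (cone_univ ▸ (contDiffOn_component hu (i, 1)).continuousOn)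
      (fun x _ => hu.mapsTo (mem_univ _) i)
      (fun x hx t ht => component_smul hx ht _) (fun x hx t ht => component_smul hx ht _)
    rw [← cone_univ] at hc
    obtain ⟨φ, hφ, hhom, hA, hB⟩ := exists_contDiffOn_phase hu i (hr i) hc
    have hd : ∀ x ∈ cone univ, fderiv ℝ φ x = 0 := by
      intro x hx
      obtain ⟨t, ht, htx⟩ := exists_scale hx.1
      have hsq : ∀ y : E5, (y 4) ^ 2 ≤ ‖y‖ ^ 2 := fun y => by
        rw [← sq_abs]
        exact pow_le_pow_left₀ (abs_nonneg _) (PiLp.norm_apply_le y 4) 2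
      -- With `b = -2` the lower face also has `‖x‖² ≥ 4`, so no boundary condition enters and the
      -- value of `c` is immaterial.
      refine hu.fderiv_phase_eq_zero hK i (hr i) (b := -2) (c := 0) (by norm_num)
        (fun y _ hy => (hmem y).2 hy) hφ hhom hA hB (fun y _ hy => Or.inl ?_) (hnhds x hx.1) ht
        htx ?_
      · have := hsq y
        rw [hy] at this
        linarith
      · have := hsq (t • x)
        rw [htx] at this
        nlinarith
    have hpre : IsPreconnected (cone univ) := by
      rw [cone_univ]
      have hrank : 1 < Module.rank ℝ E5 := by
        rw [← Module.finrank_eq_rank, finrank_euclideanSpace_fin]; norm_num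
      exact (isConnected_compl_singleton_of_one_lt_rank hrank 0).isPreconnected
    have hopen : IsOpen (cone univ) := by rw [cone_univ]; exact isOpen_compl_singleton
    obtain ⟨a, ha⟩ := hopen.exists_is_const_of_fderiv_eq_zero hpre
      (hφ.differentiableOn (by norm_num)) hd
    exact ⟨a, fun x hx => by rw [hA x hx, hB x hx, ha x hx]; exact ⟨rfl, rfl⟩⟩
  choose a ha using hphase
  -- Any base point would do; this is the default value of `radialProj`.
  let x₀ : S4 := radialProj 0
  refine ⟨u x₀, hu.mapsTo (mem_univ _), fun x => ?_⟩
  have hx := fun i => ha i x (coe_mem_cone (mem_univ x))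
  have hx₀ := fun i => ha i x₀ (coe_mem_cone (mem_univ x₀))
  simp only [radialProj_coe] at hx hx₀
  ext ⟨i, j⟩
  fin_cases j
  · exact (hx i).1.trans (hx₀ i).1.symm
  · exact (hx i).2.trans (hx₀ i).2.symm

theorem carriesNoHalfSphere_flatTorus (hr : ∀ i, 0 < r i) : CarriesNoHalfSphere (flatTorus r) := by
  intro u hu c _ hbc hbd
  have hK : UniqueDiffOn ℝ (cone halfSphere) := by
    rw [cone_halfSphere]; exact uniqueDiffOn_upperHalf
  have hmem : ∀ x : E5, x ∈ cone halfSphere ↔ x ≠ 0 ∧ 0 ≤ x 4 := by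
    intro x; rw [cone_halfSphere]; rfl
  let I : Set E5 := {x | 0 < x 4}
  have hIo : IsOpen I := isOpen_lt continuous_const (by fun_prop)
  have hI0 : ∀ x ∈ I, x ≠ 0 := by
    rintro x hx rfl
    exact lt_irrefl (0 : ℝ) hx
  have hIK : I ⊆ cone halfSphere := fun x hx => (hmem x).2 ⟨hI0 x hx, le_of_lt hx⟩
  have hIc : IsPreconnected I := by
    refine Convex.isPreconnected fun x hx y hy a b ha hb hab => ?_
    have hx' : 0 < x 4 := hx
    have hy' : 0 < y 4 := hy
    change 0 < (a • x + b • y) 4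
    simp only [PiLp.add_apply, PiLp.smul_apply, smul_eq_mul]
    rcases ha.lt_or_eq with h | h
    · positivity
    · rw [← h, zero_add] at hab
      rw [← h, hab]
      linarith
  have hKI : cone halfSphere ⊆ closure I := by
    intro x hx
    have h4 := ((hmem x).1 hx).2
    have hlim : Filter.Tendsto (fun t : ℝ => x + t • (EuclideanSpace.single 4 1 : E5))
        (nhdsWithin 0 (Ioi 0)) (nhds x) := by
      have : Continuous fun t : ℝ => x + t • (EuclideanSpace.single 4 1 : E5) := by fun_prop
      simpa using (this.tendsto 0).mono_left nhdsWithin_le_nhds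
    refine mem_closure_of_tendsto hlim ?_
    filter_upwards [self_mem_nhdsWithin] with t ht
    have ht' : 0 < t := ht
    change 0 < (x + t • (EuclideanSpace.single 4 1 : E5)) 4
    simp
    linarith
  have hequ : ∀ x : E5, x ≠ 0 → x 4 = 0 → radialProj x ∈ equator := by
    intro x hx h4
    change (radialProj x : E5) 4 = 0
    rw [coe_radialProj hx]
    simp [h4]
  let e : E5 := EuclideanSpace.single 0 1
  have he0 : e ≠ 0 := by simp [e]
  have he4 : e 4 = 0 := by simp [e]
  have heK : e ∈ cone halfSphere := (hmem e).2 ⟨he0, he4.ge⟩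
  have hcomp : ∀ i, ∀ x ∈ cone halfSphere,
      u (radialProj x) (i, 0) = c (i, 0) ∧ u (radialProj x) (i, 1) = c (i, 1) := by
    intro i
    have hc := exists_phase_upperHalf (hr i) (A := fun y => u (radialProj y) (i, 0))
      (B := fun y => u (radialProj y) (i, 1))
      (cone_halfSphere ▸ (contDiffOn_component hu (i, 0)).continuousOn)
      (cone_halfSphere ▸ (contDiffOn_component hu (i, 1)).continuousOn)
      (fun x hx => by
        rw [← cone_halfSphere] at hx
        exact hu.mapsTo hx.2 i)
      (fun x hx t ht => component_smul hx.1 ht _) (fun x hx t ht => component_smul hx.1 ht _)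
    rw [← cone_halfSphere] at hc
    obtain ⟨φ, hφ, hhom, hA, hB⟩ := exists_contDiffOn_phase hu i (hr i) hc
    have hφ1 : DifferentiableOn ℝ φ (cone halfSphere) := hφ.differentiableOn (by norm_num)
    have hbK : ∀ x : E5, x ≠ 0 ∧ x 4 = 0 → x ∈ cone halfSphere := fun x hx =>
      (hmem x).2 ⟨hx.1, hx.2.ge⟩
    -- Constant boundary values of `u` fix the phase only modulo `2π`; connectedness of the
    -- equatorial cone makes it a single constant there, which is then used as the `c` of the test
    -- function.
    obtain ⟨k, hk⟩ := exists_int_of_cos_sin_eq isPreconnected_equatorialCone (φ := φ)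
      (ψ := fun _ => φ e) (hφ.continuousOn.mono hbK) continuousOn_const
      (fun x hx => mul_left_cancel₀ (hr i).ne' (by
        rw [← hA x (hbK x hx), ← hA e heK, hbc _ (hequ x hx.1 hx.2), hbc _ (hequ e he0 he4)]))
      (fun x hx => mul_left_cancel₀ (hr i).ne' (by
        rw [← hB x (hbK x hx), ← hB e heK, hbc _ (hequ x hx.1 hx.2), hbc _ (hequ e he0 he4)]))
    have hpd : ∀ x : E5, x ≠ 0 ∧ x 4 = 0 → pd (cone halfSphere) 4 φ x = 0 := by
      intro x hx
      have hxK := hbK x hx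
      have hU := fderivWithin_extension_eq_zero hK hu.contMDiffOn hxK (hbd _ (hequ x hx.1 hx.2))
      have hj : ∀ j, pd (cone halfSphere) 4 (fun y => u (radialProj y) j) x = 0 := by
        intro j
        have h1 := ((contDiffOn_extension hu.contMDiffOn).differentiableOn
          (by norm_num) x hxK).hasFDerivWithinAt
        rw [hU] at h1
        have h2 := (((EuclideanSpace.proj j : EuclideanSpace ℝ (Fin n × Fin 2) →L[ℝ]
          ℝ)).hasFDerivAt.comp_hasFDerivWithinAt x h1).fderivWithin (hK x hxK)
        change fderivWithin ℝ (fun y => u (radialProj y) j) (cone halfSphere) x = _ at h2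
        rw [pd, h2]
        simp
      have h1 := pd_of_phase hK hφ1 hA hB 4 hxK
      rw [hj, hj] at h1
      have h2 := hu.mapsTo hxK.2 i
      refine (mul_eq_zero.1 (?_ : r i ^ 2 * pd (cone halfSphere) 4 φ x = 0)).resolve_left
        (pow_pos (hr i) 2).ne'
      rw [← h2]
      -- From `B ∂φ = 0` and `A ∂φ = 0` it follows that `(A² + B²) ∂φ = 0`.
      linear_combination (u (radialProj x) (i, 1)) * h1.1 - (u (radialProj x) (i, 0)) * h1.2
    have hd : ∀ x ∈ I, fderiv ℝ φ x = 0 := by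
      intro x hx
      obtain ⟨t, ht, htx⟩ := exists_scale (hI0 x hx)
      refine hu.fderiv_phase_eq_zero hK i (hr i) (b := 0) (c := φ e + 2 * Real.pi * k) (by norm_num)
        (fun y hy hy0 => (hmem y).2 ⟨hy0, hy⟩) hφ hhom hA hB
        (fun y hy hy4 => Or.inr ⟨hk y ⟨hy.1, hy4⟩, hpd y ⟨hy.1, hy4⟩⟩)
        (Filter.mem_of_superset (hIo.mem_nhds hx) hIK) ht htx ?_
      exact mul_pos ht hx
    obtain ⟨a, ha⟩ := hIo.exists_is_const_of_fderiv_eq_zero hIc (hφ1.mono hIK) hd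
    -- The gradient is only known to vanish in the open halfspace; continuity carries the constant
    -- to the boundary, where it is the prescribed value.
    have hφa : EqOn φ (fun _ => a) (cone halfSphere) :=
      EqOn.of_subset_closure ha hφ.continuousOn continuousOn_const hIK hKI
    intro x hx
    have hce : u (radialProj e) = c := hbc _ (hequ e he0 he4)
    rw [hA x hx, hB x hx, ← hce, hA e heK, hB e heK, hφa hx, hφa heK]
    exact ⟨rfl, rfl⟩
  intro x hx
  have h := fun i => hcomp i x (coe_mem_cone hx)
  simp only [radialProj_coe] at h
  ext ⟨i, j⟩
  fin_cases j
  · exact (h i).1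
  · exact (h i).2

end liouville

end Paneitz

theorem mainTheorem6 (n : ℕ) (hn : 1 ≤ n) (r : Fin n → ℝ) (hr : ∀ i, 0 < r i) :
    Paneitz.CarriesNoSphere (Paneitz.flatTorus r) ∧
      Paneitz.CarriesNoHalfSphere (Paneitz.flatTorus r) :=
  ⟨Paneitz.carriesNoSphere_flatTorus hr, Paneitz.carriesNoHalfSphere_flatTorus hr⟩
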